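/- **Definitions.** A weak $*$-Hopf algebra is a unital complex $*$-algebra $A$ with linear maps $\Delta:A\to A\otimes A$, $\varepsilon:A\to\mathbb C$, $S:A\to A$ such that, for all $x,y\in A$ (with $\Delta(x)=x_{(1)}\otimes x_{(2)}$), $\Delta$ is coassociative with counit $\varepsilon$, $\Delta(xy)=\Delta(x)\Delta(y)$, $\Delta(x^*)=\Delta(x)^*$, $\varepsilon(xy)=\varepsilon(x1_{(1)})\varepsilon(1_{(2)}y)$, $\varepsilon(x^*x)\ge 0$, $S(xy)=S(y)S(x)$, $S(S(x^*)^*)=x$, $\Delta\circ S=(S\otimes S)\circ\Delta^{op}$, and $S(x_{(1)})x_{(2)}\otimes x_{(3)}=1_{(1)}\otimes x1_{(2)}$. It is a weak $C^*$-Hopf algebra if moreover $A$ has a faithful $*$-representation on a Hilbert space. Put $\Pi^L(x)=x_{(1)}S(x_{(2)})$ and $\Pi^R(x)=S(x_{(1)})x_{(2)}$. For finite-dimensional $A$, the dual $\hat A$ is the space of linear functionals on $A$, with product $\langle\varphi\psi,x\rangle=\langle\varphi,x_{(1)}\rangle\langle\psi,x_{(2)}\rangle$, unit $\hat 1=\varepsilon$,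 coproduct $\langle\hat\Delta(\varphi),x\otimes y\rangle=\langle\varphi,xy\rangle$, counit $\hat\varepsilon(\varphi)=\langle\varphi,1\rangle$, antipode $\langle\hat S(\varphi),x\rangle=\langle\varphi,S(x)\rangle$ and involution $\langle\varphi^*,x\rangle=\overline{\langle\varphi,S(x)^*\rangle}$; the maps $\hat\Pi^{L}(\varphi)=\varphi_{(1)}\hat S(\varphi_{(2)})$, $\hat\Pi^{R}(\varphi)=\hat S(\varphi_{(1)})\varphi_{(2)}$ have images $\hat A^L$, $\hat A^R$. Finally $\langle x\to\varphi,y\rangle=\langle\varphi,yx\rangle$ and $\langle\varphi\leftarrow x,y\rangle=\langle\varphi,xy\rangle$. Positive elements of $\hat A$ are the finite sums of elements $\psi^*\psi$. **Theorem.** Let $A$ be a finite-dimensional weak $C^*$-Hopf algebra. There exists a unique $h\in A$ (the Haar measure) such that $$xh=\Pi^L(x)h,\qquad hx=h\Pi^R(x)\qquad(x\in A),\qquad \Pi^L(h)=1=\Pi^R(h).$$ It has the following properties. 1. $h^2=h=h^*=S(h)$. 2. The functional $\varphi\mapsto\langle\varphi,h\rangle$ on $\hat A$ is positive and faithful: $\langle\varphi^*\varphi,h\rangle\ge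 0$ for all $\varphi\in\hat A$; $\langle\varphi^*\varphi,h\rangle=0$ implies $\varphi=0$; and if $\varphi$ is positive and $\langle\varphi,h\rangle=0$ then $\varphi=0$. 3. $\langle\hat 1,h\rangle=\varepsilon(1)$. 4. $h_{(1)}x\otimes h_{(2)}=h_{(1)}\otimes h_{(2)}S(x)$ for all $x\in A$. 5. (Invariance) $\langle(x\to\varphi)\psi,h\rangle=\langle\varphi(S(x)\to\psi),h\rangle$ and $\langle(\varphi\leftarrow x)\psi,h\rangle=\langle\varphi(\psi\leftarrow S^{-1}(x)),h\rangle$ for all $x\in A$ and $\varphi,\psi\in\hat A$. 6. $\hat A^L$ and $\hat A^R$ are unital $*$-subalgebras of $\hat A$, and $\varphi\mapsto h\to\varphi$ and $\varphi\mapsto\varphi\leftarrow h$ are conditional expectations (positive, $*$-preserving, bimodule projections) from $\hat A$ onto $\hat A^L$ and $\hat A^R$, respectively. Moreover $\hat A$ has a faithful $*$-representation on a Hilbert space (so it is a $C^*$-algebra), and $(\hat A,\hat 1,\hat\Delta,\hat\varepsilon,\hat S)$ satisfies all axioms of a weak $*$-Hopf algebra; that is, $\hat A$ is again a weak $C^*$-Hopf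 algebra. -/

import Mathlib

open scoped TensorProduct ComplexOrder

universe u

noncomputable section

/-- `x ↦ x₍₁₎ S(x₍₂₎)`, for a comultiplication `Δ` and a linear map `S`. -/
def targetMap {A : Type u} [Ring A] [Algebra ℂ A]
    (Δ : A →ₗ[ℂ] A ⊗[ℂ] A) (S : A →ₗ[ℂ] A) : A →ₗ[ℂ] A :=
  LinearMap.mul' ℂ A ∘ₗ TensorProduct.map LinearMap.id S ∘ₗ Δ

/-- `x ↦ S(x₍₁₎) x₍₂₎`, for a comultiplication `Δ` and a linear map `S`. -/
def sourceMap {A : Type u} [Ring A] [Algebra ℂ A]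
    (Δ : A →ₗ[ℂ] A ⊗[ℂ] A) (S : A →ₗ[ℂ] A) : A →ₗ[ℂ] A :=
  LinearMap.mul' ℂ A ∘ₗ TensorProduct.map S LinearMap.id ∘ₗ Δ

/-- A weak `*`-Hopf algebra: a unital complex `*`-algebra with a coassociative counital coalgebra
structure (`Coalgebra ℂ A`) and an antipode, subject to the weak Hopf axioms. -/
class WeakStarHopfAlgebra (A : Type u) [Ring A] [StarRing A] [Algebra ℂ A] [StarModule ℂ A]
    extends Coalgebra ℂ A where
  /-- the antipode `S` -/
  antipode : A →ₗ[ℂ] A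
  /-- `Δ(xy) = Δ(x) Δ(y)`; `Δ(1) = 1 ⊗ 1` is not required -/
  comul_mul : ∀ x y : A, comul (x * y) = comul x * comul y
  /-- `Δ(x*) = Δ(x)*` -/
  comul_star : ∀ x : A, comul (star x) = star (comul x)
  /-- `ε(xy) = ε(x 1₍₁₎) ε(1₍₂₎ y)` -/
  counit_mul : ∀ x y : A, counit (x * y) =
    LinearMap.mul' ℂ ℂ (TensorProduct.map counit counit
      ((x ⊗ₜ[ℂ] (1 : A)) * comul (1 : A) * ((1 : A) ⊗ₜ[ℂ] y)))
  /-- `ε(x* x) ≥ 0` (in particular this number is real) -/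
  counit_star_mul_self_nonneg : ∀ x : A, 0 ≤ counit (star x * x)
  /-- `S(xy) = S(y) S(x)` -/
  antipode_mul : ∀ x y : A, antipode (x * y) = antipode y * antipode x
  /-- `S ∘ * ∘ S ∘ * = id` -/
  antipode_star : ∀ x : A, antipode (star (antipode (star x))) = x
  /-- `Δ ∘ S = (S ⊗ S) ∘ Δᵒᵖ` -/
  comul_antipode : ∀ x : A, comul (antipode x) =
    TensorProduct.map antipode antipode (TensorProduct.comm ℂ A A (comul x))
  /-- `S(x₍₁₎) x₍₂₎ ⊗ x₍₃₎ = 1₍₁₎ ⊗ x 1₍₂₎` -/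
  antipode_axiom : ∀ x : A,
    TensorProduct.map (sourceMap comul antipode) LinearMap.id (comul x) =
      ((1 : A) ⊗ₜ[ℂ] x) * comul (1 : A)

/-- The unital `*`-algebra `A` has a faithful `*`-representation on a Hilbert space. A weak
`*`-Hopf algebra with this property is a weak C*-Hopf algebra; for finite dimensional `A` the
property says that `A` is a C*-algebra. -/
def HasFaithfulStarRep (A : Type u) [Ring A] [StarRing A] [Algebra ℂ A] : Prop :=
  ∃ (H : Type u) (_ : NormedAddCommGroup H) (_ : InnerProductSpace ℂ H) (_ : CompleteSpace H)
    (π : A →⋆ₐ[ℂ] (H →L[ℂ] H)), Function.Injective π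

namespace WeakStarHopfAlgebra

open Coalgebra

section Basic

variable (A : Type u) [Ring A] [StarRing A] [Algebra ℂ A] [StarModule ℂ A]
  [WeakStarHopfAlgebra A]

/-- `Π^L(x) = x₍₁₎ S(x₍₂₎)`. -/
def piL : A →ₗ[ℂ] A := targetMap comul antipode

/-- `Π^R(x) = S(x₍₁₎) x₍₂₎`. -/
def piR : A →ₗ[ℂ] A := sourceMap comul antipode

variable {A}

theorem star_antipode_star_antipode (x : A) :
    star (antipode (star (antipode x))) = x := by
  have h := antipode_star (star x)
  rw [star_star] at h
  rw [h, star_star]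

variable (A) in
/-- The antipode as a linear bijection; its inverse is `x ↦ S(x*)*`. -/
def antipodeEquiv : A ≃ₗ[ℂ] A where
  __ := (antipode : A →ₗ[ℂ] A)
  invFun x := star (antipode (star x))
  left_inv := star_antipode_star_antipode
  right_inv := antipode_star

/-- `h` is a Haar measure in `A`: a normalized two-sided integral. -/
structure IsHaar (h : A) : Prop where
  left_integral : ∀ x : A, x * h = piL A x * h
  right_integral : ∀ x : A, h * x = h * piR A x
  piL_eq_one : piL A h = 1
  piR_eq_one : piR A h = 1

end Basic

/-- The dual `Â`, the space of linear functionals on `A`. -/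
def Dual (A : Type u) [Ring A] [Algebra ℂ A] : Type u := WithConv (A →ₗ[ℂ] ℂ)

namespace Dual

variable {A : Type u} [Ring A] [StarRing A] [Algebra ℂ A] [StarModule ℂ A]
  [WeakStarHopfAlgebra A]

/-- The product is the transpose of the comultiplication (convolution), and the unit is the
counit of `A`. -/
instance : Ring (Dual A) := inferInstanceAs (Ring (WithConv (A →ₗ[ℂ] ℂ)))

instance : Algebra ℂ (Dual A) := inferInstanceAs (Algebra ℂ (WithConv (A →ₗ[ℂ] ℂ)))

variable (A) in
/-- The identification of `Â` with the space of linear functionals. -/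
def toFunctional : Dual A ≃ₗ[ℂ] Module.Dual ℂ A where
  toFun φ := WithConv.ofConv φ
  invFun f := WithConv.toConv f
  map_add' _ _ := rfl
  map_smul' _ _ := rfl
  left_inv _ := rfl
  right_inv _ := rfl

/-- The canonical pairing `⟨φ, x⟩`. -/
def pair (φ : Dual A) (x : A) : ℂ := toFunctional A φ x

theorem ext_pair {φ ψ : Dual A} (h : ∀ x, pair φ x = pair ψ x) : φ = ψ :=
  (toFunctional A).injective (LinearMap.ext h)

theorem pair_mul (φ ψ : Dual A) (x : A) :
    pair (φ * ψ) x = LinearMap.mul' ℂ ℂ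
      (TensorProduct.map (toFunctional A φ) (toFunctional A ψ) (comul x)) := rfl

theorem pair_one (x : A) : pair (1 : Dual A) x = counit (R := ℂ) x := rfl

/-- `⟨φ*, x⟩` is the complex conjugate of `⟨φ, S(x)*⟩`. -/
instance : Star (Dual A) where
  star φ := (toFunctional A).symm
    { toFun := fun x => star (pair φ (star (antipode x)))
      map_add' := fun x y => by simp [pair]
      map_smul' := fun c x => by simp [pair] }

theorem pair_star (φ : Dual A) (x : A) :
    pair (star φ) x = star (pair φ (star (antipode x))) := rfl

theorem conj_pair_comm (φ ψ : Dual A) (t : A ⊗[ℂ] A) :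
    star (LinearMap.mul' ℂ ℂ (TensorProduct.map (toFunctional A φ) (toFunctional A ψ)
      (star (TensorProduct.map antipode antipode (TensorProduct.comm ℂ A A t))))) =
    LinearMap.mul' ℂ ℂ (TensorProduct.map (toFunctional A (star ψ)) (toFunctional A (star φ)) t) := by
  induction t with
  | zero => simp
  | tmul x y =>
    simp only [TensorProduct.comm_tmul, TensorProduct.map_tmul, TensorProduct.star_tmul,
      LinearMap.mul'_apply, star_mul]
    rfl
  | add s t hs ht => simp only [map_add, star_add, hs, ht]

instance : StarRing (Dual A) where
  star_involutive φ := ext_pair fun x => by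
    rw [pair_star, pair_star, star_star, star_antipode_star_antipode]
  star_mul φ ψ := ext_pair fun x => by
    rw [pair_star, pair_mul, pair_mul, comul_star, comul_antipode, conj_pair_comm]
  star_add φ ψ := ext_pair fun x => by
    change star (pair φ _ + pair ψ _) = star (pair φ _) + star (pair ψ _)
    exact star_add _ _

instance : StarModule ℂ (Dual A) where
  star_smul c φ := ext_pair fun x => by
    change star (c * pair φ _) = star c * star (pair φ _)
    rw [star_mul, mul_comm]

/-- The antipode of the dual: `⟨Ŝ(φ), x⟩ = ⟨φ, S(x)⟩`. -/
def dualAntipode : Dual A →ₗ[ℂ] Dual A :=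
  (toFunctional A).symm.toLinearMap ∘ₗ (antipode : A →ₗ[ℂ] A).dualMap ∘ₗ
    (toFunctional A).toLinearMap

/-- The counit of the dual: `φ ↦ ⟨φ, 1⟩`. -/
def dualCounit : Dual A →ₗ[ℂ] ℂ :=
  Module.Dual.eval ℂ A 1 ∘ₗ (toFunctional A).toLinearMap

/-- The comultiplication of the dual, the transpose of the multiplication of `A`:
`⟨Δ̂(φ), x ⊗ y⟩ = ⟨φ, x y⟩` under the identification of `Â ⊗ Â` with the dual of `A ⊗ A`. -/
def dualComul [FiniteDimensional ℂ A] : Dual A →ₗ[ℂ] Dual A ⊗[ℂ] Dual A :=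
  (TensorProduct.map (toFunctional A).symm.toLinearMap (toFunctional A).symm.toLinearMap) ∘ₗ
    (TensorProduct.dualDistribEquiv ℂ A A).symm.toLinearMap ∘ₗ
      (LinearMap.mul' ℂ A).dualMap ∘ₗ (toFunctional A).toLinearMap

/-- The left Sweedler arrow `x → φ = φ₍₁₎ ⟨φ₍₂₎, x⟩`, that is, `⟨x → φ, y⟩ = ⟨φ, y x⟩`. -/
def arrowL (x : A) : Dual A →ₗ[ℂ] Dual A :=
  (toFunctional A).symm.toLinearMap ∘ₗ (LinearMap.mulRight ℂ x).dualMap ∘ₗ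
    (toFunctional A).toLinearMap

/-- The right Sweedler arrow `φ ← x = ⟨φ₍₁₎, x⟩ φ₍₂₎`, that is, `⟨φ ← x, y⟩ = ⟨φ, x y⟩`. -/
def arrowR (x : A) : Dual A →ₗ[ℂ] Dual A :=
  (toFunctional A).symm.toLinearMap ∘ₗ (LinearMap.mulLeft ℂ x).dualMap ∘ₗ
    (toFunctional A).toLinearMap

theorem pair_dualComul [FiniteDimensional ℂ A] (φ : Dual A) (x y : A) :
    TensorProduct.dualDistrib ℂ A A (TensorProduct.map (toFunctional A).toLinearMap
      (toFunctional A).toLinearMap (dualComul φ)) (x ⊗ₜ[ℂ] y) = pair φ (x * y) := by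
  have h : ∀ t : Module.Dual ℂ A ⊗[ℂ] Module.Dual ℂ A,
      TensorProduct.map (toFunctional A).toLinearMap (toFunctional A).toLinearMap
        (TensorProduct.map (toFunctional A).symm.toLinearMap
          (toFunctional A).symm.toLinearMap t) = t := by
    intro t
    induction t with
    | zero => simp
    | tmul f g => simp
    | add s t hs ht => simp only [map_add, hs, ht]
  have h2 : ∀ f : Module.Dual ℂ (A ⊗[ℂ] A),
      TensorProduct.dualDistrib ℂ A A ((TensorProduct.dualDistribEquiv ℂ A A).symm f) = f :=
    fun f => (TensorProduct.dualDistribEquiv ℂ A A).apply_symm_apply f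
  simp only [dualComul, LinearMap.comp_apply, LinearEquiv.coe_coe] at *
  rw [h, h2]
  rfl

/-- The arrow `x → φ` is `φ₍₁₎ ⟨φ₍₂₎, x⟩`. -/
theorem arrowL_eq [FiniteDimensional ℂ A] (x : A) (φ : Dual A) :
    arrowL x φ = TensorProduct.rid ℂ (Dual A) (TensorProduct.map LinearMap.id
      (Module.Dual.eval ℂ A x ∘ₗ (toFunctional A).toLinearMap) (dualComul φ)) := by
  refine ext_pair fun y => ?_
  change pair φ (y * x) = _
  rw [← pair_dualComul]
  induction dualComul φ with
  | zero => simp [pair]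
  | tmul f g => simp [pair, mul_comm]
  | add s t hs ht =>
    simp only [map_add, LinearMap.add_apply, hs, ht]
    rfl

/-- The arrow `φ ← x` is `⟨φ₍₁₎, x⟩ φ₍₂₎`. -/
theorem arrowR_eq [FiniteDimensional ℂ A] (x : A) (φ : Dual A) :
    arrowR x φ = TensorProduct.lid ℂ (Dual A) (TensorProduct.map
      (Module.Dual.eval ℂ A x ∘ₗ (toFunctional A).toLinearMap) LinearMap.id (dualComul φ)) := by
  refine ext_pair fun y => ?_
  change pair φ (x * y) = _
  rw [← pair_dualComul]
  induction dualComul φ with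
  | zero => simp [pair]
  | tmul f g => simp [pair]
  | add s t hs ht =>
    simp only [map_add, LinearMap.add_apply, hs, ht]
    rfl

end Dual

end WeakStarHopfAlgebra

/-- The positive elements of a `*`-algebra: the finite sums of elements `y* y`. -/
def IsPositiveElement {B : Type u} [Ring B] [StarRing B] (b : B) : Prop :=
  b ∈ AddSubmonoid.closure (Set.range fun y : B => star y * y)

/-- `E` is a conditional expectation from the `*`-algebra `B` onto its unital `*`-subalgebra `C`. -/
structure IsConditionalExpectation {B : Type u} [Ring B] [StarRing B] [Algebra ℂ B]
    [StarModule ℂ B] (E : B →ₗ[ℂ] B) (C : StarSubalgebra ℂ B) : Prop where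
  mem : ∀ b, E b ∈ C
  apply_of_mem : ∀ c ∈ C, E c = c
  bimodule : ∀ c ∈ C, ∀ d ∈ C, ∀ b, E (c * b * d) = c * E b * d
  map_star : ∀ b, E (star b) = star (E b)
  positive : ∀ b, IsPositiveElement b → IsPositiveElement (E b)

end

open WeakStarHopfAlgebra WeakStarHopfAlgebra.Dual Coalgebra

/-! The four expansions of $x_{(1)}\otimes x_{(2)}$ with one leg passed through a counital map
express that leg through $\Delta(1)$. One is an axiom and the others follow by applying the antipode
and the involution. With the counit they show that $\Pi^L(x)$ depends only on the functional
$a\mapsto\varepsilon(ax)$, so that $\Pi^L(x\Pi^L(y))=\Pi^L(xy)$, and likewise for $\Pi^R$.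

Existence of $h$: by the first identity $\ker\Pi^L$ is a left ideal. The trace `tr` of the left
regular representation is positive and faithful, so $\langle x,y\rangle=\mathrm{tr}(x^*y)$ is an
inner product. The component $l$ of $1$ orthogonal to $\ker\Pi^L$ is a normalized left integral, and
traciality gives $l=ll^*$. A self-adjoint normalized left integral is automatically two-sided
(`exists_isHaar`, `isHaar_of_star_eq`). Uniqueness holds because $hk$ equals both $k$ and $h$; it
also forces $h^*=h=S(h)$.

Positivity and faithfulness on the dual: $\Delta(h)$ is a projection, so
$c=(\mathrm{tr}\otimes\mathrm{id})\Delta(h)$ has the form $\sum b_i^*b_i$. Writing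
$\varphi=\mathrm{tr}(a\,\cdot)$ and $\psi=\mathrm{tr}(d\,\cdot)$, the exchange rule $h_{(1)}x\otimes
h_{(2)}=h_{(1)}\otimes h_{(2)}S(x)$ and $\mathrm{tr}\circ S=\mathrm{tr}$ turn
$\langle\varphi^*\psi,h\rangle$ into $\mathrm{tr}(d\,c\,a^*)$, a Gram form (`IsHaar.exists_gram`).
It is definite because $cx=0$ forces $x=0$.

The Gram form also gives positivity of the two arrows by $h$, and the GNS construction for
evaluation at $h$ represents $\hat A$ faithfully. The axioms of $\hat A$ are transposes of
identities in $A$; only the counit and antipode axioms need the formulas for $\Delta(1)$. -/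

noncomputable section

namespace WeakStarHopfAlgebra

/-! ### Counital maps, their expansions through $\Delta(1)$, and the counit -/

section Axioms

variable {A : Type u} [Ring A] [StarRing A] [Algebra ℂ A] [StarModule ℂ A]
  [WeakStarHopfAlgebra A]

theorem antipode_one : antipode (1 : A) = 1 := by
  obtain ⟨y, hy⟩ := (antipodeEquiv A).surjective 1
  change antipode y = 1 at hy
  have h := antipode_mul y 1
  rwa [mul_one, hy, mul_one, eq_comm] at h

theorem antipode_injective : Function.Injective (antipode : A →ₗ[ℂ] A) :=
  (antipodeEquiv A).injective

theorem antipodeEquiv_symm_apply (x : A) :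
    (antipodeEquiv A).symm x = star (antipode (star x)) := rfl

theorem antipode_symm_apply (x : A) : antipode ((antipodeEquiv A).symm x) = x :=
  antipode_star x

theorem symm_antipode_apply (x : A) : (antipodeEquiv A).symm (antipode x) = x :=
  star_antipode_star_antipode x

theorem star_antipode (x : A) : star (antipode x) = (antipodeEquiv A).symm (star x) := by
  rw [antipodeEquiv_symm_apply, star_star]

theorem piR_antipode (x : A) : piR A (antipode x) = antipode (piL A x) := by
  have h : ∀ t : A ⊗[ℂ] A, LinearMap.mul' ℂ A (TensorProduct.map antipode LinearMap.id
      (TensorProduct.map antipode antipode (TensorProduct.comm ℂ A A t))) =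
      antipode (LinearMap.mul' ℂ A (TensorProduct.map LinearMap.id antipode t)) := by
    intro t
    induction t with
    | zero => simp
    | tmul a b => simp [antipode_mul]
    | add s t hs ht => simp only [map_add, hs, ht]
  simp only [piR, piL, sourceMap, targetMap, LinearMap.comp_apply, comul_antipode, h]

theorem piL_antipode (x : A) : piL A (antipode x) = antipode (piR A x) := by
  have h : ∀ t : A ⊗[ℂ] A, LinearMap.mul' ℂ A (TensorProduct.map LinearMap.id antipode
      (TensorProduct.map antipode antipode (TensorProduct.comm ℂ A A t))) =
      antipode (LinearMap.mul' ℂ A (TensorProduct.map antipode LinearMap.id t)) := by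
    intro t
    induction t with
    | zero => simp
    | tmul a b => simp [antipode_mul]
    | add s t hs ht => simp only [map_add, hs, ht]
  simp only [piR, piL, sourceMap, targetMap, LinearMap.comp_apply, comul_antipode, h]

/-- `star (Π^L (x*)) = S⁻¹ (Π^R x)`. -/
theorem star_piL (x : A) :
    star (piL A x) = (antipodeEquiv A).symm (piR A (star x)) := by
  have h : ∀ t : A ⊗[ℂ] A, star (LinearMap.mul' ℂ A (TensorProduct.map LinearMap.id antipode t)) =
      (antipodeEquiv A).symm
        (LinearMap.mul' ℂ A (TensorProduct.map antipode LinearMap.id (star t))) := by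
    intro t
    induction t with
    | zero => simp
    | tmul a b =>
      simp only [TensorProduct.map_tmul, LinearMap.id_apply, LinearMap.mul'_apply, star_mul,
        TensorProduct.star_tmul]
      rw [antipodeEquiv_symm_apply, star_mul, antipode_mul, star_mul]
      simp only [star_antipode_star_antipode, star_star]
    | add s t hs ht => simp only [map_add, star_add, hs, ht]
  simp only [piR, piL, sourceMap, targetMap, LinearMap.comp_apply, comul_star, h]

/-- `star (Π^R (x*)) = S⁻¹ (Π^L x)`. -/
theorem star_piR (x : A) :
    star (piR A x) = (antipodeEquiv A).symm (piL A (star x)) := by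
  apply antipode_injective
  have h := star_piL (star x)
  rw [star_star] at h
  rw [antipode_symm_apply, ← star_star (piL A (star x)), h, antipodeEquiv_symm_apply,
    star_star]

/-! ### The four expansions of the comultiplication through `Δ(1)` -/

theorem map_piR_comul (x : A) : TensorProduct.map (piR A) LinearMap.id (comul (R := ℂ) x) =
    ((1 : A) ⊗ₜ[ℂ] x) * comul (R := ℂ) (1 : A) := antipode_axiom x

/-- This is the antipode axiom at $S(x)$: since $\Delta\circ S=(S\otimes S)\Delta^{op}$ and
$S(1)=1$, both sides are images under the injective map $S\otimes S$ composed with the flip. -/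
theorem map_piL_comul (x : A) : TensorProduct.map LinearMap.id (piL A) (comul (R := ℂ) x) =
    comul (R := ℂ) (1 : A) * (x ⊗ₜ[ℂ] (1 : A)) := by
  have h1 : ∀ t : A ⊗[ℂ] A, TensorProduct.map (piR A) LinearMap.id
      (TensorProduct.map antipode antipode (TensorProduct.comm ℂ A A t)) =
      TensorProduct.map antipode antipode (TensorProduct.comm ℂ A A
        (TensorProduct.map LinearMap.id (piL A) t)) := by
    intro t
    induction t with
    | zero => simp
    | tmul a b => simp [piR_antipode]
    | add s t hs ht => simp only [map_add, hs, ht]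
  have h2 : ∀ t : A ⊗[ℂ] A, ((1 : A) ⊗ₜ[ℂ] antipode x) *
      (TensorProduct.map antipode antipode (TensorProduct.comm ℂ A A t)) =
      TensorProduct.map antipode antipode (TensorProduct.comm ℂ A A (t * (x ⊗ₜ[ℂ] (1 : A)))) := by
    intro t
    induction t with
    | zero => simp
    | tmul a b => simp [antipode_mul]
    | add s t hs ht => simp only [map_add, mul_add, add_mul, hs, ht]
  have h := map_piR_comul (antipode x)
  rw [comul_antipode, h1, ← antipode_one, comul_antipode 1, antipode_one, h2] at h
  exact (TensorProduct.comm ℂ A A).injective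
    ((TensorProduct.congr (antipodeEquiv A) (antipodeEquiv A)).injective h)

theorem star_comul_one : star (comul (R := ℂ) (1 : A)) = comul (R := ℂ) (1 : A) := by
  rw [← comul_star, star_one]

variable (A) in
/-- `x ↦ x₍₂₎ S⁻¹(x₍₁₎)`. -/
def piRBar : A →ₗ[ℂ] A := (antipodeEquiv A).symm.toLinearMap ∘ₗ piL A

variable (A) in
/-- `x ↦ S⁻¹(x₍₂₎) x₍₁₎`. -/
def piLBar : A →ₗ[ℂ] A := (antipodeEquiv A).symm.toLinearMap ∘ₗ piR A

theorem star_piL' (x : A) : star (piL A x) = piLBar A (star x) := star_piL x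

theorem star_piR' (x : A) : star (piR A x) = piRBar A (star x) := star_piR x

theorem antipode_piRBar (x : A) : antipode (piRBar A x) = piL A x := antipode_symm_apply _

theorem antipode_piLBar (x : A) : antipode (piLBar A x) = piR A x := antipode_symm_apply _

theorem map_piRBar_comul (x : A) :
    TensorProduct.map (piRBar A) LinearMap.id (comul (R := ℂ) x) =
      comul (R := ℂ) (1 : A) * ((1 : A) ⊗ₜ[ℂ] x) := by
  have h1 : ∀ t : A ⊗[ℂ] A, TensorProduct.map (piRBar A) LinearMap.id (star t) =
      star (TensorProduct.map (piR A) LinearMap.id t) := by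
    intro t
    induction t with
    | zero => simp
    | tmul a b => simp [star_piR']
    | add s t hs ht => simp only [map_add, star_add, hs, ht]
  rw [← star_star x, comul_star, h1, map_piR_comul, star_mul, star_comul_one,
    TensorProduct.star_tmul, star_one]

theorem map_piLBar_comul (x : A) :
    TensorProduct.map LinearMap.id (piLBar A) (comul (R := ℂ) x) =
      (x ⊗ₜ[ℂ] (1 : A)) * comul (R := ℂ) (1 : A) := by
  have h1 : ∀ t : A ⊗[ℂ] A, TensorProduct.map LinearMap.id (piLBar A) (star t) =
      star (TensorProduct.map LinearMap.id (piL A) t) := by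
    intro t
    induction t with
    | zero => simp
    | tmul a b => simp [star_piL']
    | add s t hs ht => simp only [map_add, star_add, hs, ht]
  rw [← star_star x, comul_star, h1, map_piL_comul, star_mul, star_comul_one,
    TensorProduct.star_tmul, star_one]

/-! ### The four maps in terms of the counit -/

theorem rid_map_counit_comul (x : A) :
    TensorProduct.rid ℂ A (TensorProduct.map LinearMap.id counit (comul (R := ℂ) x)) = x := by
  have h := lTensor_counit_comul (R := ℂ) x
  rw [LinearMap.lTensor] at h
  rw [h]
  simp

theorem lid_map_counit_comul (x : A) :
    TensorProduct.lid ℂ A (TensorProduct.map counit LinearMap.id (comul (R := ℂ) x)) = x := by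
  have h := rTensor_counit_comul (R := ℂ) x
  rw [LinearMap.rTensor] at h
  rw [h]
  simp

theorem rid_map_map_counit_comul (f : A →ₗ[ℂ] A) (x : A) :
    TensorProduct.rid ℂ A (TensorProduct.map LinearMap.id counit
      (TensorProduct.map f LinearMap.id (comul (R := ℂ) x))) = f x := by
  have h : ∀ t : A ⊗[ℂ] A, TensorProduct.rid ℂ A (TensorProduct.map LinearMap.id counit
      (TensorProduct.map f LinearMap.id t)) =
      f (TensorProduct.rid ℂ A (TensorProduct.map LinearMap.id counit t)) := by
    intro t
    induction t with
    | zero => simp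
    | tmul a b => simp
    | add s t hs ht => simp only [map_add, hs, ht]
  rw [h, rid_map_counit_comul]

theorem lid_map_map_counit_comul (f : A →ₗ[ℂ] A) (x : A) :
    TensorProduct.lid ℂ A (TensorProduct.map counit LinearMap.id
      (TensorProduct.map LinearMap.id f (comul (R := ℂ) x))) = f x := by
  have h : ∀ t : A ⊗[ℂ] A, TensorProduct.lid ℂ A (TensorProduct.map counit LinearMap.id
      (TensorProduct.map LinearMap.id f t)) =
      f (TensorProduct.lid ℂ A (TensorProduct.map counit LinearMap.id t)) := by
    intro t
    induction t with
    | zero => simp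
    | tmul a b => simp
    | add s t hs ht => simp only [map_add, hs, ht]
  rw [h, lid_map_counit_comul]

theorem piR_eq (x : A) : piR A x = TensorProduct.rid ℂ A (TensorProduct.map LinearMap.id counit
    (((1 : A) ⊗ₜ[ℂ] x) * comul (R := ℂ) (1 : A))) := by
  rw [← map_piR_comul, rid_map_map_counit_comul]

theorem piRBar_eq (x : A) : piRBar A x = TensorProduct.rid ℂ A (TensorProduct.map LinearMap.id
    counit (comul (R := ℂ) (1 : A) * ((1 : A) ⊗ₜ[ℂ] x))) := by
  rw [← map_piRBar_comul, rid_map_map_counit_comul]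

theorem piL_eq (x : A) : piL A x = TensorProduct.lid ℂ A (TensorProduct.map counit LinearMap.id
    (comul (R := ℂ) (1 : A) * (x ⊗ₜ[ℂ] (1 : A)))) := by
  rw [← map_piL_comul, lid_map_map_counit_comul]

theorem piLBar_eq (x : A) : piLBar A x = TensorProduct.lid ℂ A (TensorProduct.map counit
    LinearMap.id ((x ⊗ₜ[ℂ] (1 : A)) * comul (R := ℂ) (1 : A))) := by
  rw [← map_piLBar_comul, lid_map_map_counit_comul]

theorem piL_one : piL A 1 = 1 := by
  rw [piL_eq, ← Algebra.TensorProduct.one_def, mul_one, lid_map_counit_comul]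

theorem piR_one : piR A 1 = 1 := by
  rw [piR_eq, ← Algebra.TensorProduct.one_def, one_mul, rid_map_counit_comul]

/-- Polarization: the numbers $\varepsilon(y^*y)$ are real for $y=1$, $x$, $1+x$ and $1+ix$. -/
theorem counit_star (x : A) : counit (R := ℂ) (star x) = star (counit (R := ℂ) x) := by
  have key : ∀ y : A, (counit (R := ℂ) (star y * y)).im = 0 := fun y =>
    ((Complex.nonneg_iff.mp (counit_star_mul_self_nonneg y)).2).symm
  have h0 := key 1
  have hx := key x
  have h1 := key (1 + x)
  have h2 := key (1 + Complex.I • x)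
  simp only [star_add, star_one, star_smul, add_mul, mul_add, one_mul, mul_one, map_add,
    smul_mul_assoc, mul_smul_comm, map_smul, Complex.add_im, smul_eq_mul] at h0 hx h1 h2
  simp at h0 hx h1 h2
  apply Complex.ext
  · simp
    linarith
  · simp
    linarith

/-- Weak multiplicativity of the counit, with the first leg of $(x\otimes 1)\Delta(1)$ contracted.
Contracting the other leg gives `counit_mul_piRBar`; the versions for `piL` and `piR` follow by
complex conjugation. -/
theorem counit_piLBar_mul (x y : A) :
    counit (R := ℂ) (piLBar A x * y) = counit (R := ℂ) (x * y) := by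
  have h : ∀ t : A ⊗[ℂ] A, counit (R := ℂ) (TensorProduct.lid ℂ A
      (TensorProduct.map (counit (R := ℂ)) LinearMap.id t) * y) =
      LinearMap.mul' ℂ ℂ (TensorProduct.map counit counit (t * ((1 : A) ⊗ₜ[ℂ] y))) := by
    intro t
    induction t with
    | zero => simp
    | tmul a b => simp
    | add s t hs ht => simp only [map_add, add_mul, hs, ht]
  rw [piLBar_eq, h, ← counit_mul]

theorem counit_mul_piRBar (x y : A) :
    counit (R := ℂ) (x * piRBar A y) = counit (R := ℂ) (x * y) := by
  have h : ∀ t : A ⊗[ℂ] A, counit (R := ℂ) (x * TensorProduct.rid ℂ A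
      (TensorProduct.map LinearMap.id (counit (R := ℂ)) t)) =
      LinearMap.mul' ℂ ℂ (TensorProduct.map counit counit ((x ⊗ₜ[ℂ] (1 : A)) * t)) := by
    intro t
    induction t with
    | zero => simp
    | tmul a b => simp [mul_comm]
    | add s t hs ht => simp only [map_add, mul_add, hs, ht]
  rw [piRBar_eq, h, ← mul_assoc, ← counit_mul]

theorem counit_mul_piL (x y : A) :
    counit (R := ℂ) (x * piL A y) = counit (R := ℂ) (x * y) := by
  rw [← star_star (x * piL A y), counit_star, star_mul, star_piL', counit_piLBar_mul, ← star_mul,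
    ← counit_star, star_star]

theorem counit_piR_mul (x y : A) :
    counit (R := ℂ) (piR A x * y) = counit (R := ℂ) (x * y) := by
  rw [← star_star (piR A x * y), counit_star, star_mul, star_piR', counit_mul_piRBar, ← star_mul,
    ← counit_star, star_star]

theorem counit_piL (x : A) : counit (R := ℂ) (piL A x) = counit (R := ℂ) x := by
  simpa using counit_mul_piL 1 x

theorem counit_piR (x : A) : counit (R := ℂ) (piR A x) = counit (R := ℂ) x := by
  simpa using counit_piR_mul x 1

/-- By `piL_eq`, $\Pi^L(x)=\varepsilon(1_{(1)}x)1_{(2)}$ sees $x$ only through these numbers.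
Identities for $\Pi^L$ thereby reduce to identities for $\varepsilon$. -/
theorem piL_congr {x y : A} (h : ∀ a : A, counit (R := ℂ) (a * x) = counit (R := ℂ) (a * y)) :
    piL A x = piL A y := by
  have h' : ∀ t : A ⊗[ℂ] A, TensorProduct.lid ℂ A (TensorProduct.map (counit (R := ℂ))
      LinearMap.id (t * (x ⊗ₜ[ℂ] (1 : A)))) = TensorProduct.lid ℂ A
        (TensorProduct.map (counit (R := ℂ)) LinearMap.id (t * (y ⊗ₜ[ℂ] (1 : A)))) := by
    intro t
    induction t with
    | zero => simp
    | tmul a b => simp [h]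
    | add s t hs ht => simp only [map_add, add_mul, hs, ht]
  rw [piL_eq, piL_eq, h']

theorem piR_congr {x y : A} (h : ∀ a : A, counit (R := ℂ) (x * a) = counit (R := ℂ) (y * a)) :
    piR A x = piR A y := by
  have h' : ∀ t : A ⊗[ℂ] A, TensorProduct.rid ℂ A (TensorProduct.map LinearMap.id
      (counit (R := ℂ)) (((1 : A) ⊗ₜ[ℂ] x) * t)) = TensorProduct.rid ℂ A
        (TensorProduct.map LinearMap.id (counit (R := ℂ)) (((1 : A) ⊗ₜ[ℂ] y) * t)) := by
    intro t
    induction t with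
    | zero => simp
    | tmul a b => simp [h]
    | add s t hs ht => simp only [map_add, mul_add, hs, ht]
  rw [piR_eq, piR_eq, h']

theorem piL_mul_piL (x y : A) : piL A (x * piL A y) = piL A (x * y) :=
  piL_congr fun a => by rw [← mul_assoc, counit_mul_piL, mul_assoc]

theorem piR_piR_mul (x y : A) : piR A (piR A x * y) = piR A (x * y) :=
  piR_congr fun a => by rw [mul_assoc, counit_piR_mul, mul_assoc]

theorem piL_piL (x : A) : piL A (piL A x) = piL A x := by
  simpa using piL_mul_piL 1 x

theorem piR_piR (x : A) : piR A (piR A x) = piR A x := by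
  simpa using piR_piR_mul x 1

theorem piL_star_piR (x : A) : piL A (star (piR A x)) = piL A (star x) :=
  piL_congr fun a => by
    rw [← star_star a, ← star_mul, ← star_mul, counit_star, counit_star, counit_piR_mul]

theorem piR_star_piL (x : A) : piR A (star (piL A x)) = piR A (star x) :=
  piR_congr fun a => by
    rw [← star_star a, ← star_mul, ← star_mul, counit_star, counit_star, counit_mul_piL]

/-- `x₍₁₎ ε(y x₍₂₎) = Π^R(y) x`. -/
theorem piR_mul_eq (x y : A) : piR A x * y = TensorProduct.rid ℂ A
    (TensorProduct.map LinearMap.id (counit ∘ₗ LinearMap.mulLeft ℂ x) (comul (R := ℂ) y)) := by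
  have h1 : ∀ t : A ⊗[ℂ] A, TensorProduct.rid ℂ A (TensorProduct.map LinearMap.id
      (counit (R := ℂ)) (((1 : A) ⊗ₜ[ℂ] x) * t)) * y = TensorProduct.rid ℂ A (TensorProduct.map
        LinearMap.id (counit ∘ₗ LinearMap.mulLeft ℂ x) (t * (y ⊗ₜ[ℂ] (1 : A)))) := by
    intro t
    induction t with
    | zero => simp
    | tmul a b => simp
    | add s t hs ht => simp only [map_add, mul_add, add_mul, hs, ht]
  have h2 : ∀ t : A ⊗[ℂ] A, TensorProduct.map (LinearMap.id : A →ₗ[ℂ] A)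
      ((counit (R := ℂ)) ∘ₗ LinearMap.mulLeft ℂ x) (TensorProduct.map LinearMap.id (piL A) t) =
      TensorProduct.map LinearMap.id (counit ∘ₗ LinearMap.mulLeft ℂ x) t := by
    intro t
    induction t with
    | zero => simp
    | tmul a b => simp [counit_mul_piL]
    | add s t hs ht => simp only [map_add, hs, ht]
  rw [piR_eq, h1, ← map_piL_comul, h2]

end Axioms

/-! ### Integrals: uniqueness, symmetry and the exchange rule for $\Delta(h)$ -/

section Integrals

variable {A : Type u} [Ring A] [StarRing A] [Algebra ℂ A] [StarModule ℂ A]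
  [WeakStarHopfAlgebra A]

/-- The adjoint relation involves $S^{-1}\circ\Pi^R$ in place of $\Pi^R$. That map takes the same
value at $x$ and at $\Pi^R(x)$, so the difference disappears. -/
theorem star_right_integral {l : A} (hl : ∀ x, x * l = piL A x * l) (x : A) :
    star l * x = star l * piR A x := by
  have h : ∀ y, star l * y = star l * piLBar A y := fun y => by
    rw [← star_star y, ← star_mul, hl, star_mul, star_piL']
  have h2 : piLBar A (piR A x) = piLBar A x := by
    simp only [piLBar, LinearMap.comp_apply, piR_piR]
  rw [h x, h (piR A x), h2]

theorem antipode_right_integral {l : A} (hl : ∀ x, x * l = piL A x * l) (x : A) :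
    antipode l * x = antipode l * piR A x := by
  rw [← antipode_symm_apply x, piR_antipode, ← antipode_mul, ← antipode_mul, ← hl]

theorem antipode_left_integral {r : A} (hr : ∀ x, r * x = r * piR A x) (x : A) :
    x * antipode r = piL A x * antipode r := by
  rw [← antipode_symm_apply x, piL_antipode, ← antipode_mul, ← antipode_mul, ← hr]

theorem left_integral_mul_of_piL_eq_one {l x : A} (hl : ∀ x, x * l = piL A x * l)
    (hx : piL A x = 1) : x * l = l := by
  rw [hl, hx, one_mul]

theorem star_left_integral {r : A} (hr : ∀ x, r * x = r * piR A x) (x : A) :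
    x * star r = piL A x * star r := by
  have h : ∀ y, y * star r = piRBar A y * star r := fun y => by
    rw [← star_star y, ← star_mul, hr, star_mul, star_piR']
  have h2 : piRBar A (piL A x) = piRBar A x := by
    simp only [piRBar, LinearMap.comp_apply, piL_piL]
  rw [h x, h (piL A x), h2]

/-- A self-adjoint normalized left integral is a Haar measure. -/
theorem isHaar_of_star_eq {l : A} (hl : ∀ x, x * l = piL A x * l) (h1 : piL A l = 1)
    (hs : star l = l) : IsHaar l := by
  have hr : ∀ x, l * x = l * piR A x := fun x => by
    have := star_right_integral hl x
    rwa [hs] at this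
  refine ⟨hl, hr, h1, ?_⟩
  have h2 : piR A (antipode l) = 1 := by rw [piR_antipode, h1, antipode_one]
  -- $S(l)^*$ is again a left integral, so $l$ fixes it from the left. The adjoint of this is
  -- $S(l)l=S(l)$, and since $\Pi^R(S(l))=1$, the rule $\Pi^R(\Pi^R(x)y)=\Pi^R(xy)$ transfers the
  -- normalization to $l$.
  have h3 : l * star (antipode l) = star (antipode l) :=
    left_integral_mul_of_piL_eq_one (star_left_integral (antipode_right_integral hl)) h1
  have h4 : antipode l * l = antipode l := by
    rw [← star_star (antipode l * l), star_mul, hs, h3, star_star]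
  rw [← h2, ← h4, ← piR_piR_mul, h2, one_mul]

/-- The product $hk$ is $k$ because $k$ is a left integral with $\Pi^L(h)=1$, and $h$ because $h$ is
a right integral with $\Pi^R(k)=1$. -/
theorem IsHaar.eq {h k : A} (hh : IsHaar h) (hk : IsHaar k) : h = k := by
  have h1 : h * k = k := left_integral_mul_of_piL_eq_one hk.left_integral hh.piL_eq_one
  have h2 : h * k = h := by rw [hh.right_integral, hk.piR_eq_one, mul_one]
  rw [← h1, h2]

theorem IsHaar.mul_self {h : A} (hh : IsHaar h) : h * h = h :=
  left_integral_mul_of_piL_eq_one hh.left_integral hh.piL_eq_one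

theorem IsHaar.antipode_eq {h : A} (hh : IsHaar h) : antipode h = h :=
  IsHaar.eq ⟨antipode_left_integral hh.right_integral, antipode_right_integral hh.left_integral,
    by rw [piL_antipode, hh.piR_eq_one, antipode_one],
    by rw [piR_antipode, hh.piL_eq_one, antipode_one]⟩ hh

theorem IsHaar.star_eq {h : A} (hh : IsHaar h) : star h = h := by
  refine IsHaar.eq ⟨star_left_integral hh.right_integral, star_right_integral hh.left_integral,
    ?_, ?_⟩ hh
  · rw [← piL_star_piR, hh.piR_eq_one, star_one, piL_one]
  · rw [← piR_star_piL, hh.piL_eq_one, star_one, piR_one]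

theorem IsHaar.counit_eq {h : A} (hh : IsHaar h) :
    counit (R := ℂ) h = counit (R := ℂ) (1 : A) := by
  rw [← counit_piL, hh.piL_eq_one]

/-- `x₍₁₎ ⊗ x₍₂₎ S(x₍₃₎) = 1₍₁₎ x ⊗ 1₍₂₎`. -/
theorem comul_mul_antipode (x : A) :
    LinearMap.mul' ℂ (A ⊗[ℂ] A) (TensorProduct.map (comul (R := ℂ))
      (TensorProduct.mk ℂ A A 1 ∘ₗ antipode) (comul (R := ℂ) x)) =
      comul (R := ℂ) (1 : A) * (x ⊗ₜ[ℂ] (1 : A)) := by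
  have h : ∀ t : A ⊗[ℂ] A, LinearMap.mul' ℂ (A ⊗[ℂ] A) (TensorProduct.map (comul (R := ℂ))
      (TensorProduct.mk ℂ A A 1 ∘ₗ antipode) t) =
      TensorProduct.map LinearMap.id (LinearMap.mul' ℂ A ∘ₗ TensorProduct.map LinearMap.id antipode)
        (TensorProduct.assoc ℂ A A A (comul.rTensor A t)) := by
    intro t
    induction t with
    | zero => simp
    | tmul a b =>
      simp only [TensorProduct.map_tmul, LinearMap.comp_apply, TensorProduct.mk_apply,
        LinearMap.mul'_apply, LinearMap.rTensor_tmul]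
      induction comul (R := ℂ) a with
      | zero => simp
      | tmul c d => simp
      | add s t hs ht => simp only [map_add, add_mul, TensorProduct.add_tmul, hs, ht]
    | add s t hs ht => simp only [map_add, hs, ht]
  have h2 : ∀ t : A ⊗[ℂ] A, TensorProduct.map (LinearMap.id : A →ₗ[ℂ] A)
      (LinearMap.mul' ℂ A ∘ₗ TensorProduct.map LinearMap.id antipode) (comul.lTensor A t) =
      TensorProduct.map LinearMap.id (piL A) t := by
    intro t
    induction t with
    | zero => simp
    | tmul a b => simp [piL, targetMap]
    | add s t hs ht => simp only [map_add, hs, ht]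
  rw [h, coassoc_apply, h2, map_piL_comul]

/-- `h₍₁₎ x ⊗ h₍₂₎ = h₍₁₎ ⊗ h₍₂₎ S(x)` for a right integral `h`. -/
theorem comul_right_integral_mul {h : A} (hr : ∀ x, h * x = h * piR A x) (x : A) :
    comul (R := ℂ) h * (x ⊗ₜ[ℂ] (1 : A)) = comul (R := ℂ) h * ((1 : A) ⊗ₜ[ℂ] antipode x) := by
  -- $F(a\otimes b)=\Delta(ha)(1\otimes S(b))$, so $F(\Delta(y))=\Delta(h)(y\otimes 1)$. As
  -- $ha=h\Pi^R(a)$, the map $F$ does not change when $\Pi^R$ is applied to the first leg; this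
  -- replaces $\Delta(x)$ by $(1\otimes x)\Delta(1)$, and $x$ then leaves on the right as $S(x)$.
  set F : A ⊗[ℂ] A →ₗ[ℂ] A ⊗[ℂ] A := LinearMap.mulLeft ℂ (comul (R := ℂ) h) ∘ₗ
    LinearMap.mul' ℂ (A ⊗[ℂ] A) ∘ₗ TensorProduct.map (comul (R := ℂ))
      (TensorProduct.mk ℂ A A 1 ∘ₗ antipode) with hF
  have hFt : ∀ a b : A, F (a ⊗ₜ b) = comul (R := ℂ) (h * a) * ((1 : A) ⊗ₜ[ℂ] antipode b) := by
    intro a b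
    simp [hF, comul_mul, mul_assoc]
  have h1 : ∀ y : A, F (comul (R := ℂ) y) = comul (R := ℂ) h * (y ⊗ₜ[ℂ] (1 : A)) := by
    intro y
    rw [hF, LinearMap.comp_apply, LinearMap.comp_apply, comul_mul_antipode,
      LinearMap.mulLeft_apply, ← mul_assoc, ← comul_mul, mul_one]
  have h2 : ∀ t : A ⊗[ℂ] A, F t = F (TensorProduct.map (piR A) LinearMap.id t) := by
    intro t
    induction t with
    | zero => simp
    | tmul a b => rw [TensorProduct.map_tmul, hFt, hFt, ← hr, LinearMap.id_apply]
    | add s t hs ht => simp only [map_add, ← hs, ← ht]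
  have h3 : ∀ t : A ⊗[ℂ] A, F (((1 : A) ⊗ₜ[ℂ] x) * t) = F t * ((1 : A) ⊗ₜ[ℂ] antipode x) := by
    intro t
    induction t with
    | zero => simp
    | tmul a b => simp [hFt, antipode_mul, mul_assoc]
    | add s t hs ht => simp only [map_add, mul_add, add_mul, hs, ht]
  rw [← h1, h2, map_piR_comul, h3, h1, ← Algebra.TensorProduct.one_def, mul_one]

theorem IsHaar.comul_mul_tmul {h : A} (hh : IsHaar h) (x : A) :
    comul (R := ℂ) h * (x ⊗ₜ[ℂ] (1 : A)) = comul (R := ℂ) h * ((1 : A) ⊗ₜ[ℂ] antipode x) :=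
  comul_right_integral_mul hh.right_integral x

theorem IsHaar.tmul_mul_comul {h : A} (hh : IsHaar h) (x : A) :
    (x ⊗ₜ[ℂ] (1 : A)) * comul (R := ℂ) h =
      ((1 : A) ⊗ₜ[ℂ] (antipodeEquiv A).symm x) * comul (R := ℂ) h := by
  have h1 := congrArg star (hh.comul_mul_tmul (star x))
  simpa only [star_mul, TensorProduct.star_tmul, star_one, star_star, ← comul_star, hh.star_eq,
    star_antipode] using h1

end Integrals

/-! ### Invariance of evaluation at $h$ -/

namespace Dual

variable {A : Type u} [Ring A] [StarRing A] [Algebra ℂ A] [StarModule ℂ A]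
  [WeakStarHopfAlgebra A]

/-- The functional `φ ⊗ ψ` on `A ⊗ A`. -/
def pair₂ (φ ψ : Dual A) : A ⊗[ℂ] A →ₗ[ℂ] ℂ :=
  LinearMap.mul' ℂ ℂ ∘ₗ TensorProduct.map (toFunctional A φ) (toFunctional A ψ)

@[simp] theorem pair₂_tmul (φ ψ : Dual A) (x y : A) :
    pair₂ φ ψ (x ⊗ₜ[ℂ] y) = pair φ x * pair ψ y := rfl

theorem pair_mul_eq (φ ψ : Dual A) (x : A) :
    pair (φ * ψ) x = pair₂ φ ψ (comul (R := ℂ) x) := rfl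

theorem pair_arrowL (φ : Dual A) (x y : A) : pair (arrowL x φ) y = pair φ (y * x) := rfl

theorem pair_arrowR (φ : Dual A) (x y : A) : pair (arrowR x φ) y = pair φ (x * y) := rfl

@[simp] theorem pair_add_right (φ : Dual A) (x y : A) : pair φ (x + y) = pair φ x + pair φ y :=
  map_add (toFunctional A φ) x y

@[simp] theorem pair_zero_right (φ : Dual A) : pair φ (0 : A) = 0 :=
  map_zero (toFunctional A φ)

@[simp] theorem pair_smul_right (φ : Dual A) (c : ℂ) (x : A) : pair φ (c • x) = c * pair φ x :=
  map_smul (toFunctional A φ) c x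

@[simp] theorem pair_add_left (φ ψ : Dual A) (x : A) : pair (φ + ψ) x = pair φ x + pair ψ x :=
  rfl

@[simp] theorem pair_zero_left (x : A) : pair (0 : Dual A) x = 0 := rfl

@[simp] theorem pair_smul_left (c : ℂ) (φ : Dual A) (x : A) : pair (c • φ) x = c * pair φ x :=
  rfl

theorem pair₂_arrowL_left (φ ψ : Dual A) (x : A) (t : A ⊗[ℂ] A) :
    pair₂ (arrowL x φ) ψ t = pair₂ φ ψ (t * (x ⊗ₜ[ℂ] (1 : A))) := by
  induction t with
  | zero => simp
  | tmul a b => simp [pair_arrowL]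
  | add s t hs ht => simp only [map_add, add_mul, hs, ht]

theorem pair₂_arrowL_right (φ ψ : Dual A) (x : A) (t : A ⊗[ℂ] A) :
    pair₂ φ (arrowL x ψ) t = pair₂ φ ψ (t * ((1 : A) ⊗ₜ[ℂ] x)) := by
  induction t with
  | zero => simp
  | tmul a b => simp [pair_arrowL]
  | add s t hs ht => simp only [map_add, add_mul, hs, ht]

theorem pair₂_arrowR_left (φ ψ : Dual A) (x : A) (t : A ⊗[ℂ] A) :
    pair₂ (arrowR x φ) ψ t = pair₂ φ ψ ((x ⊗ₜ[ℂ] (1 : A)) * t) := by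
  induction t with
  | zero => simp
  | tmul a b => simp [pair_arrowR]
  | add s t hs ht => simp only [map_add, mul_add, hs, ht]

theorem pair₂_arrowR_right (φ ψ : Dual A) (x : A) (t : A ⊗[ℂ] A) :
    pair₂ φ (arrowR x ψ) t = pair₂ φ ψ (((1 : A) ⊗ₜ[ℂ] x) * t) := by
  induction t with
  | zero => simp
  | tmul a b => simp [pair_arrowR]
  | add s t hs ht => simp only [map_add, mul_add, hs, ht]

theorem pair_arrowL_mul {h : A} (hh : IsHaar h) (x : A) (φ ψ : Dual A) :
    pair (arrowL x φ * ψ) h = pair (φ * arrowL (antipode x) ψ) h := by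
  rw [pair_mul_eq, pair_mul_eq, pair₂_arrowL_left, pair₂_arrowL_right, hh.comul_mul_tmul]

theorem pair_arrowR_mul {h : A} (hh : IsHaar h) (x : A) (φ ψ : Dual A) :
    pair (arrowR x φ * ψ) h = pair (φ * arrowR ((antipodeEquiv A).symm x) ψ) h := by
  rw [pair_mul_eq, pair_mul_eq, pair₂_arrowR_left, pair₂_arrowR_right, hh.tmul_mul_comul]

end Dual

end WeakStarHopfAlgebra

/-! ### Faithful positive functionals on finite-dimensional $*$-algebras -/

section FaithfulPositive

variable {B : Type u} [Ring B] [StarRing B] [Algebra ℂ B] [StarModule ℂ B]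

/-- A positive faithful functional on a `*`-algebra. -/
structure IsFaithfulPositive (τ : B →ₗ[ℂ] ℂ) : Prop where
  nonneg : ∀ x, 0 ≤ τ (star x * x)
  definite : ∀ x, τ (star x * x) = 0 → x = 0

theorem map_star_of_nonneg {τ : B →ₗ[ℂ] ℂ} (hτ : ∀ x, 0 ≤ τ (star x * x)) (x : B) :
    τ (star x) = star (τ x) := by
  have key : ∀ y : B, (τ (star y * y)).im = 0 := fun y =>
    ((Complex.nonneg_iff.mp (hτ y)).2).symm
  have h0 := key 1
  have hx := key x
  have h1 := key (1 + x)
  have h2 := key (1 + Complex.I • x)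
  simp only [star_add, star_one, star_smul, add_mul, mul_add, one_mul, mul_one, map_add,
    smul_mul_assoc, mul_smul_comm, map_smul, Complex.add_im, smul_eq_mul] at h0 hx h1 h2
  simp at h0 hx h1 h2
  apply Complex.ext
  · simp
    linarith
  · simp
    linarith

namespace IsFaithfulPositive

variable {τ : B →ₗ[ℂ] ℂ} (hτ : IsFaithfulPositive τ)

/-- The inner product `⟪x, y⟫ = τ (x* y)`. -/
@[reducible] def core : InnerProductSpace.Core ℂ B where
  inner x y := τ (star x * y)
  conj_inner_symm x y := by
    change star (τ _) = _
    rw [← map_star_of_nonneg hτ.nonneg, star_mul, star_star]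
  re_inner_nonneg x := (Complex.nonneg_iff.mp (hτ.nonneg x)).1
  add_left x y z := by rw [star_add, add_mul, map_add]
  smul_left x y r := by
    rw [star_smul, smul_mul_assoc, map_smul]
    rfl
  definite x hx := hτ.definite x hx

include hτ

theorem exists_orthonormal [FiniteDimensional ℂ B] :
    ∃ (n : ℕ) (e : Fin n → B), ∀ x, x = ∑ k, τ (star (e k) * x) • e k := by
  let _ : NormedAddCommGroup B := hτ.core.toNormedAddCommGroup
  let _ : InnerProductSpace ℂ B := InnerProductSpace.ofCore hτ.core.toCore
  let b := stdOrthonormalBasis ℂ B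
  exact ⟨_, b, fun x => (b.sum_repr' x).symm⟩

theorem exists_orthogonal_projection [FiniteDimensional ℂ B] (N : Submodule ℂ B) (x : B) :
    ∃ n ∈ N, ∀ m ∈ N, τ (star m * (x - n)) = 0 := by
  let _ : NormedAddCommGroup B := hτ.core.toNormedAddCommGroup
  let _ : InnerProductSpace ℂ B := InnerProductSpace.ofCore hτ.core.toCore
  exact ⟨N.starProjection x, N.starProjection_apply_mem x, fun m hm =>
    N.mem_orthogonal _ |>.mp (N.sub_starProjection_mem_orthogonal x) m hm⟩

/-- The GNS representation: the algebra acts on itself by left multiplication, and evaluation at $1$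
gives injectivity. -/
theorem hasFaithfulStarRep [FiniteDimensional ℂ B] : HasFaithfulStarRep B := by
  let _ : NormedAddCommGroup B := hτ.core.toNormedAddCommGroup
  let _ : InnerProductSpace ℂ B := InnerProductSpace.ofCore hτ.core.toCore
  refine ⟨B, inferInstance, inferInstance, FiniteDimensional.complete ℂ B,
    { toFun := fun x => LinearMap.toContinuousLinearMap (LinearMap.mulLeft ℂ x)
      map_one' := by ext; simp
      map_mul' := fun x y => by ext; simp
      map_zero' := by ext; simp
      map_add' := fun x y => by ext; simp [add_mul]
      commutes' := fun c => by
        ext y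
        simp [Algebra.algebraMap_eq_smul_one]
      map_star' := fun x => ?_ }, fun x y hxy => ?_⟩
  · rw [ContinuousLinearMap.star_eq_adjoint, ContinuousLinearMap.eq_adjoint_iff]
    intro y z
    change τ (star (star x * y) * z) = τ (star y * (x * z))
    rw [star_mul, star_star, mul_assoc]
  · simpa using congrArg (fun T : B →L[ℂ] B => T 1) hxy

omit [StarModule ℂ B] in
theorem eq_zero_of_isPositiveElement {b : B} (hb : IsPositiveElement b) (h0 : τ b = 0) :
    b = 0 := by
  -- Nonnegativity has to accompany definiteness through the induction: a vanishing sum of values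
  -- forces each value to vanish only if all are nonnegative.
  suffices h : 0 ≤ τ b ∧ (τ b = 0 → b = 0) from h.2 h0
  clear h0
  induction hb using AddSubmonoid.closure_induction with
  | mem x hx =>
    obtain ⟨y, rfl⟩ := hx
    refine ⟨hτ.nonneg y, fun h => ?_⟩
    rw [hτ.definite y h]
    exact mul_zero _
  | zero => exact ⟨(map_zero τ).ge, fun _ => rfl⟩
  | add x y _ _ hx hy =>
    rw [map_add]
    refine ⟨add_nonneg hx.1 hy.1, fun h => ?_⟩
    obtain ⟨h1, h2⟩ := (add_eq_zero_iff_of_nonneg hx.1 hy.1).mp h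
    rw [hx.2 h1, hy.2 h2, add_zero]

end IsFaithfulPositive

theorem LinearMap.trace_eq_sum_of_expansion {V : Type*} [AddCommGroup V] [Module ℂ V]
    [FiniteDimensional ℂ V] {n : ℕ} (e : Fin n → V) (f : Fin n → Module.Dual ℂ V)
    (h : ∀ x, x = ∑ k, f k x • e k) (T : V →ₗ[ℂ] V) :
    LinearMap.trace ℂ V T = ∑ k, f k (T (e k)) := by
  have hT : T = ∑ k, dualTensorHom ℂ V V (f k ⊗ₜ[ℂ] T (e k)) := by
    ext x
    conv_lhs => rw [h x]
    simp
  conv_lhs => rw [hT]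
  rw [map_sum]
  refine Finset.sum_congr rfl fun k _ => ?_
  rw [LinearMap.trace_eq_contract_apply]
  simp

omit [StarModule ℂ B] in
-- A finite sum of vector states $\sum_{v\in s}\langle v,\pi(x)v\rangle$ suffices. Choose $s$ so
-- that the space of $x$ with $\pi(x)$ vanishing on $s$ is minimal; adjoining any further vector
-- cannot shrink it, so it is zero.
theorem HasFaithfulStarRep.exists_isFaithfulPositive [FiniteDimensional ℂ B]
    (hB : HasFaithfulStarRep B) : ∃ τ : B →ₗ[ℂ] ℂ, IsFaithfulPositive τ := by
  obtain ⟨H, _, _, _, π, hπ⟩ := hB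
  let K : Finset H → Submodule ℂ B := fun s =>
    { carrier := {x | ∀ v ∈ s, π x v = 0}
      add_mem' := fun {x y} hx hy v hv => by simp [hx v hv, hy v hv]
      zero_mem' := fun v _ => by simp
      smul_mem' := fun c x hx v hv => by simp [hx v hv] }
  obtain ⟨_, ⟨s, rfl⟩, hs⟩ := IsArtinian.set_has_minimal (Set.range K) (Set.range_nonempty K)
  have hK : ∀ x ∈ K s, x = 0 := by
    classical
    intro x hx
    apply hπ
    rw [map_zero]
    ext v
    have hle : K (insert v s) ≤ K s := fun y hy w hw => hy w (Finset.mem_insert_of_mem hw)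
    have hnl := hs _ ⟨insert v s, rfl⟩
    have heq : K (insert v s) = K s := by
      by_contra hne
      exact hnl (lt_of_le_of_ne hle hne)
    have : x ∈ K (insert v s) := by rw [heq]; exact hx
    simpa using this v (Finset.mem_insert_self v s)
  have hval : ∀ x : B, ∀ v : H, inner ℂ v (π (star x * x) v) = ((‖π x v‖ ^ 2 : ℝ) : ℂ) := by
    intro x v
    rw [map_mul, map_star, mul_apply_eq_comp, ContinuousLinearMap.star_eq_adjoint,
      ContinuousLinearMap.adjoint_inner_right, inner_self_eq_norm_sq_to_K]
    simp
  refine ⟨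
    { toFun := fun x => ∑ v ∈ s, inner ℂ v (π x v)
      map_add' := fun x y => by simp [Finset.sum_add_distrib]
      map_smul' := fun c x => by simp [Finset.mul_sum] }, fun x => ?_,
    fun x hx => hK x fun v hv => ?_⟩
  · change 0 ≤ ∑ v ∈ s, inner ℂ v (π (star x * x) v)
    simp only [hval]
    exact Finset.sum_nonneg fun v _ => Complex.zero_le_real.mpr (sq_nonneg _)
  · change ∑ v ∈ s, inner ℂ v (π (star x * x) v) = 0 at hx
    simp only [hval] at hx
    rw [Finset.sum_eq_zero_iff_of_nonneg fun v _ => Complex.zero_le_real.mpr (sq_nonneg _)] at hx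
    have := hx v hv
    simpa using this

end FaithfulPositive

/-! ### The trace of the left regular representation -/

section RegularTrace

variable {B : Type u} [Ring B] [Algebra ℂ B]

variable (B) in
/-- The trace of the left regular representation. -/
def regularTrace : B →ₗ[ℂ] ℂ := LinearMap.trace ℂ B ∘ₗ (Algebra.lmul ℂ B).toLinearMap

theorem regularTrace_apply (x : B) :
    regularTrace B x = LinearMap.trace ℂ B (LinearMap.mulLeft ℂ x) := rfl

theorem regularTrace_mul_comm (x y : B) : regularTrace B (x * y) = regularTrace B (y * x) := by
  simp only [regularTrace_apply, LinearMap.mulLeft_mul]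
  exact LinearMap.trace_mul_comm ℂ (LinearMap.mulLeft ℂ x) (LinearMap.mulLeft ℂ y)

variable (B) in
/-- The map `x ⊗ y ↦ tr(x) y` for the trace of the left regular representation. -/
def contractTrace : B ⊗[ℂ] B →ₗ[ℂ] B :=
  (TensorProduct.lid ℂ B).toLinearMap ∘ₗ TensorProduct.map (regularTrace B) LinearMap.id

theorem contractTrace_tmul (x y : B) :
    contractTrace B (x ⊗ₜ[ℂ] y) = regularTrace B x • y := rfl

theorem contractTrace_mul_tmul_one (t : B ⊗[ℂ] B) (x : B) :
    contractTrace B (t * (x ⊗ₜ[ℂ] (1 : B))) = contractTrace B ((x ⊗ₜ[ℂ] (1 : B)) * t) := by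
  induction t with
  | zero => simp
  | tmul a b => simp [contractTrace_tmul, regularTrace_mul_comm a x]
  | add s t hs ht => simp only [map_add, mul_add, add_mul, hs, ht]

theorem contractTrace_mul_one_tmul (t : B ⊗[ℂ] B) (x : B) :
    contractTrace B (t * ((1 : B) ⊗ₜ[ℂ] x)) = contractTrace B t * x := by
  induction t with
  | zero => simp
  | tmul a b => simp [contractTrace_tmul]
  | add s t hs ht => simp only [map_add, add_mul, hs, ht]

theorem contractTrace_one_tmul_mul (t : B ⊗[ℂ] B) (x : B) :
    contractTrace B (((1 : B) ⊗ₜ[ℂ] x) * t) = x * contractTrace B t := by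
  induction t with
  | zero => simp
  | tmul a b => simp [contractTrace_tmul]
  | add s t hs ht => simp only [map_add, mul_add, hs, ht]

variable [FiniteDimensional ℂ B] [StarRing B] [StarModule ℂ B]

/-- In an orthonormal basis for any faithful positive $\tau$, the trace of left multiplication by
$x^*x$ is $\sum_k\tau((xe_k)^*(xe_k))$. -/
theorem isFaithfulPositive_regularTrace (hB : HasFaithfulStarRep B) :
    IsFaithfulPositive (regularTrace B) := by
  obtain ⟨τ, hτ⟩ := hB.exists_isFaithfulPositive
  obtain ⟨n, e, he⟩ := hτ.exists_orthonormal
  have h : ∀ x, regularTrace B (star x * x) = ∑ k, τ (star (x * e k) * (x * e k)) := by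
    intro x
    rw [regularTrace_apply, LinearMap.trace_eq_sum_of_expansion e
      (fun k => τ ∘ₗ LinearMap.mulLeft ℂ (star (e k))) he]
    simp [mul_assoc]
  refine ⟨fun x => ?_, fun x hx => ?_⟩
  · rw [h]
    exact Finset.sum_nonneg fun k _ => hτ.nonneg _
  · rw [h, Finset.sum_eq_zero_iff_of_nonneg fun k _ => hτ.nonneg _] at hx
    rw [← mul_one x, he 1, Finset.mul_sum]
    exact Finset.sum_eq_zero fun k hk => by
      rw [mul_smul_comm, hτ.definite _ (hx k hk), smul_zero]

/-- Traciality makes $(e_k^*)$ an orthonormal basis along with $(e_k)$. Computing the left trace in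
$(e_k)$ and the right trace in $(e_k^*)$ gives the same sum up to cyclic permutation. -/
theorem trace_mulRight (hB : HasFaithfulStarRep B) (x : B) :
    LinearMap.trace ℂ B (LinearMap.mulRight ℂ x) = regularTrace B x := by
  have ht := isFaithfulPositive_regularTrace hB
  obtain ⟨n, e, he⟩ := ht.exists_orthonormal
  have he' : ∀ y, y = ∑ k, regularTrace B (e k * y) • star (e k) := by
    intro y
    conv_lhs => rw [← star_star y, he (star y), star_sum]
    refine Finset.sum_congr rfl fun k _ => ?_
    rw [star_smul, ← map_star_of_nonneg ht.nonneg, star_mul, star_star, star_star,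
      regularTrace_mul_comm]
  rw [regularTrace_apply, LinearMap.trace_eq_sum_of_expansion e
      (fun k => regularTrace B ∘ₗ LinearMap.mulLeft ℂ (star (e k))) he,
    LinearMap.trace_eq_sum_of_expansion (fun k => star (e k))
      (fun k => regularTrace B ∘ₗ LinearMap.mulLeft ℂ (e k)) he']
  refine Finset.sum_congr rfl fun k _ => ?_
  simp only [LinearMap.comp_apply, LinearMap.mulLeft_apply, LinearMap.mulRight_apply]
  rw [regularTrace_mul_comm (star (e k)), ← mul_assoc]

end RegularTrace

/-! ### Existence of the Haar measure and its Gram form on the dual -/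

namespace WeakStarHopfAlgebra

variable {A : Type u} [Ring A] [StarRing A] [Algebra ℂ A] [StarModule ℂ A]
  [WeakStarHopfAlgebra A] [FiniteDimensional ℂ A]

theorem exists_isHaar (hA : HasFaithfulStarRep A) : ∃ h : A, IsHaar h := by
  have ht := isFaithfulPositive_regularTrace hA
  -- $n$ is the projection of $1$ onto $\ker\Pi^L$, and $l=1-n$. Since the kernel is a left ideal,
  -- all of $Al$ is orthogonal to it, so an element of $Al$ lying in the kernel is zero.
  obtain ⟨n, hn, horth⟩ := ht.exists_orthogonal_projection (LinearMap.ker (piL A)) 1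
  obtain ⟨l, rfl⟩ : ∃ l, n = 1 - l := ⟨1 - n, by abel⟩
  rw [sub_sub_cancel] at horth
  have hideal : ∀ x m : A, piL A m = 0 → piL A (x * m) = 0 := fun x m hm => by
    rw [← piL_mul_piL, hm, mul_zero, map_zero]
  have horth' : ∀ x m : A, piL A m = 0 → regularTrace A (star m * (x * l)) = 0 := fun x m hm => by
    have := horth (star x * m) (hideal _ _ hm)
    rwa [star_mul, star_star, mul_assoc] at this
  have hl1 : piL A l = 1 := by
    rw [LinearMap.mem_ker, map_sub, piL_one, sub_eq_zero] at hn
    exact hn.symm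
  have hleft : ∀ x, x * l = piL A x * l := fun x => by
    rw [← sub_eq_zero, ← sub_mul]
    have hm : piL A ((x - piL A x) * l) = 0 := by
      rw [← piL_mul_piL, hl1, mul_one, map_sub, piL_piL, sub_self]
    exact ht.definite _ (horth' _ _ hm)
  -- By traciality the squared norm of $l(1-l)^*$ is $\mathrm{tr}((1-l)^*(1-l)l^*l)$, the inner
  -- product of $1-l\in\ker\Pi^L$ with an element of $Al$.
  have hmul : l * star (1 - l) = 0 := by
    apply ht.definite
    have := horth' ((1 - l) * star l) (1 - l) (LinearMap.mem_ker.mp hn)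
    rw [regularTrace_mul_comm, mul_assoc] at this
    rw [star_mul, star_star, ← mul_assoc, regularTrace_mul_comm]
    rw [← this, regularTrace_mul_comm]
    simp only [mul_assoc]
  have hll : l = l * star l := by
    rw [star_sub, star_one, mul_sub, mul_one, sub_eq_zero] at hmul
    exact hmul
  refine ⟨l, isHaar_of_star_eq hleft hl1 ?_⟩
  rw [hll, star_mul, star_star]

/-- The antipode conjugates right multiplication by $x$ into left multiplication by $S(x)$, and left
and right traces agree. -/
theorem regularTrace_antipode (hA : HasFaithfulStarRep A) (x : A) :
    regularTrace A (antipode x) = regularTrace A x := by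
  rw [← trace_mulRight hA x, regularTrace_apply,
    ← LinearMap.trace_conj' (LinearMap.mulRight ℂ x) (antipodeEquiv A)]
  congr 1
  ext y
  obtain ⟨z, rfl⟩ := (antipodeEquiv A).surjective y
  rw [LinearEquiv.conj_apply_apply, LinearEquiv.symm_apply_apply]
  exact (antipode_mul z x).symm

omit [WeakStarHopfAlgebra A] in
theorem eq_zero_of_contractTrace_eq_zero (hA : HasFaithfulStarRep A) {t : A ⊗[ℂ] A}
    (ht : ∀ x : A, contractTrace A (t * (x ⊗ₜ[ℂ] (1 : A))) = 0) : t = 0 := by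
  obtain ⟨n, e, he⟩ := (isFaithfulPositive_regularTrace hA).exists_orthonormal
  have h : ∀ s : A ⊗[ℂ] A,
      s = ∑ k, e k ⊗ₜ[ℂ] contractTrace A ((star (e k) ⊗ₜ[ℂ] (1 : A)) * s) := by
    intro s
    induction s with
    | zero => simp
    | tmul a b =>
      conv_lhs => rw [he a]
      simp [contractTrace_tmul, TensorProduct.sum_tmul, TensorProduct.smul_tmul]
    | add s t hs ht =>
      conv_lhs => rw [hs, ht]
      simp only [map_add, mul_add, TensorProduct.tmul_add, Finset.sum_add_distrib]
  rw [h t]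
  exact Finset.sum_eq_zero fun k _ => by
    rw [← contractTrace_mul_tmul_one, ht, TensorProduct.tmul_zero]

omit [WeakStarHopfAlgebra A] in
-- Parseval's identity in the first leg.
theorem contractTrace_star_mul_self {n : ℕ} {e : Fin n → A}
    (he : ∀ x, x = ∑ k, regularTrace A (star (e k) * x) • e k) (hA : HasFaithfulStarRep A)
    (s t : A ⊗[ℂ] A) : contractTrace A (star s * t) =
      ∑ k, star (contractTrace A ((star (e k) ⊗ₜ[ℂ] (1 : A)) * s)) *
        contractTrace A ((star (e k) ⊗ₜ[ℂ] (1 : A)) * t) := by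
  have ht := isFaithfulPositive_regularTrace hA
  induction s with
  | zero => simp
  | add s₁ s₂ h₁ h₂ =>
    simp only [star_add, add_mul, mul_add, map_add, h₁, h₂, Finset.sum_add_distrib]
  | tmul a b =>
    induction t with
    | zero => simp
    | add t₁ t₂ h₁ h₂ => simp only [mul_add, map_add, h₁, h₂, Finset.sum_add_distrib]
    | tmul c d =>
      have h : regularTrace A (star a * c) = ∑ k, star (regularTrace A (star (e k) * a)) *
          regularTrace A (star (e k) * c) := by
        conv_lhs => rw [he c]
        simp only [Finset.mul_sum, map_sum, mul_smul_comm, map_smul, smul_eq_mul]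
        refine Finset.sum_congr rfl fun k _ => ?_
        rw [← map_star_of_nonneg ht.nonneg, star_mul, star_star, mul_comm]
      simp only [TensorProduct.star_tmul, Algebra.TensorProduct.tmul_mul_tmul, contractTrace_tmul,
        one_mul, h, star_smul, smul_mul_assoc, mul_smul_comm, smul_smul, Finset.sum_smul]
      exact Finset.sum_congr rfl fun k _ => by rw [mul_comm]

section Haar

variable {h : A}

omit [FiniteDimensional ℂ A] in
theorem IsHaar.contractTrace_mul (hh : IsHaar h) (x : A) :
    contractTrace A (comul (R := ℂ) h * (x ⊗ₜ[ℂ] (1 : A))) =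
      contractTrace A (comul (R := ℂ) h) * antipode x := by
  rw [hh.comul_mul_tmul, contractTrace_mul_one_tmul]

/-- With $c=(\mathrm{tr}\otimes\mathrm{id})\Delta(h)$, the exchange rules give $cS(y)=S^{-1}(y)c$,
so $cx=0$ implies $cAx=0$. Hence every contraction of $\Delta(h)(S^{-1}(x)\otimes 1)$ vanishes and
so does this tensor. Applying $S$ to its first leg and multiplying yields $x\,\Pi^R(h)=x$. -/
theorem IsHaar.eq_zero_of_contractTrace_mul (hA : HasFaithfulStarRep A) (hh : IsHaar h) {x : A}
    (hx : contractTrace A (comul (R := ℂ) h) * x = 0) : x = 0 := by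
  have h1 : ∀ y, contractTrace A (comul (R := ℂ) h) * antipode y =
      (antipodeEquiv A).symm y * contractTrace A (comul (R := ℂ) h) := fun y => by
    rw [← hh.contractTrace_mul, contractTrace_mul_tmul_one, hh.tmul_mul_comul,
      contractTrace_one_tmul_mul]
  have h2 : ∀ y, contractTrace A (comul (R := ℂ) h) * (y * x) = 0 := fun y => by
    rw [← antipode_symm_apply y, ← mul_assoc, h1, mul_assoc, hx, mul_zero]
  have h3 : comul (R := ℂ) h * ((antipodeEquiv A).symm x ⊗ₜ[ℂ] (1 : A)) = 0 := by
    refine eq_zero_of_contractTrace_eq_zero hA fun y => ?_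
    rw [mul_assoc, Algebra.TensorProduct.tmul_mul_tmul, mul_one, hh.contractTrace_mul,
      antipode_mul, antipode_symm_apply, h2]
  have h4 : ∀ t : A ⊗[ℂ] A, LinearMap.mul' ℂ A (TensorProduct.map antipode LinearMap.id
      (t * ((antipodeEquiv A).symm x ⊗ₜ[ℂ] (1 : A)))) =
      x * LinearMap.mul' ℂ A (TensorProduct.map antipode LinearMap.id t) := by
    intro t
    induction t with
    | zero => simp
    | tmul a b => simp [antipode_mul, antipode_symm_apply, mul_assoc]
    | add s t hs ht => simp only [map_add, mul_add, add_mul, hs, ht]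
  have h5 := h4 (comul (R := ℂ) h)
  rw [h3, map_zero, map_zero] at h5
  have h6 : LinearMap.mul' ℂ A (TensorProduct.map antipode LinearMap.id (comul (R := ℂ) h)) = 1 :=
    hh.piR_eq_one
  rw [h6, mul_one] at h5
  exact h5.symm

omit [FiniteDimensional ℂ A] in
theorem exists_eq_regularTrace {n : ℕ} {e : Fin n → A}
    (he : ∀ x, x = ∑ k, regularTrace A (star (e k) * x) • e k) (φ : Dual A) :
    ∃ a : A, ∀ x, pair φ x = regularTrace A (a * x) := by
  refine ⟨∑ k, pair φ (e k) • star (e k), fun x => ?_⟩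
  conv_lhs => rw [he x]
  change toFunctional A φ _ = _
  simp only [map_sum, map_smul, Finset.sum_mul, smul_mul_assoc]
  exact Finset.sum_congr rfl fun k _ => mul_comm _ _

/-- The pairing of `h` with `φ* ψ` is a Gram form: `⟨φ* ψ, h⟩ = ∑ conj ⟨φ, gᵢ⟩ ⟨ψ, gᵢ⟩`, and the
`gᵢ` separate the functionals. -/
theorem IsHaar.exists_gram (hA : HasFaithfulStarRep A) (hh : IsHaar h) :
    ∃ (ι : Type) (_ : Fintype ι) (g : ι → A),
      (∀ φ ψ : Dual A, pair (star φ * ψ) h = ∑ i, star (pair φ (g i)) * pair ψ (g i)) ∧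
      ∀ φ : Dual A, (∀ i, pair φ (g i) = 0) → φ = 0 := by
  have ht := isFaithfulPositive_regularTrace hA
  obtain ⟨n, e, he⟩ := ht.exists_orthonormal
  set b : Fin n → A := fun i =>
    contractTrace A ((star (e i) ⊗ₜ[ℂ] (1 : A)) * comul (R := ℂ) h) with hb
  have hc : contractTrace A (comul (R := ℂ) h) = ∑ i, star (b i) * b i := by
    rw [← contractTrace_star_mul_self he hA, ← comul_star, hh.star_eq, ← comul_mul, hh.mul_self]
  -- The $g_{ik}=b_i^*e_k$ come from expanding $b_ia^*$ in the basis $(e_k)$ inside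
  -- $\mathrm{tr}(d\,b_i^*\,b_ia^*)$.
  refine ⟨Fin n × Fin n, inferInstance, fun i => star (b i.1) * e i.2, fun φ ψ => ?_,
    fun φ hφ => ?_⟩
  · obtain ⟨a, ha⟩ := exists_eq_regularTrace he φ
    obtain ⟨d, hd⟩ := exists_eq_regularTrace he ψ
    have h1 : ∀ t : A ⊗[ℂ] A, pair₂ (star φ) ψ t = regularTrace A (d * contractTrace A
        (t * ((antipodeEquiv A).symm (star a) ⊗ₜ[ℂ] (1 : A)))) := by
      intro t
      induction t with
      | zero => simp
      | tmul u v =>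
        rw [pair₂_tmul, pair_star, ha, hd, ← map_star_of_nonneg ht.nonneg, star_mul, star_star,
          Algebra.TensorProduct.tmul_mul_tmul, contractTrace_tmul, mul_one, mul_smul_comm, map_smul,
          smul_eq_mul, ← regularTrace_antipode hA (u * _), antipode_mul, antipode_symm_apply,
          regularTrace_mul_comm (antipode u)]
      | add s t hs ht => simp only [map_add, mul_add, add_mul, hs, ht]
    rw [pair_mul_eq, h1, hh.contractTrace_mul, antipode_symm_apply, hc, Finset.sum_mul,
      Finset.mul_sum, map_sum, Fintype.sum_prod_type]
    refine Finset.sum_congr rfl fun i _ => ?_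
    have h2 : d * (star (b i) * b i * star a) =
        ∑ k, regularTrace A (star (e k) * (b i * star a)) • (d * (star (b i) * e k)) := by
      rw [mul_assoc]
      conv_lhs => rw [he (b i * star a)]
      simp only [Finset.mul_sum, mul_smul_comm]
    rw [h2, map_sum]
    refine Finset.sum_congr rfl fun k _ => ?_
    rw [map_smul, smul_eq_mul, ha, hd, ← map_star_of_nonneg ht.nonneg]
    simp only [star_mul, star_star, mul_assoc]
  · obtain ⟨a, ha⟩ := exists_eq_regularTrace he φ
    have h1 : ∀ i, b i * star a = 0 := fun i => by
      rw [he (b i * star a)]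
      refine Finset.sum_eq_zero fun k _ => ?_
      have h2 := congrArg star (hφ (i, k))
      rw [ha, ← map_star_of_nonneg ht.nonneg, star_zero] at h2
      simp only [star_mul, star_star, mul_assoc] at h2
      rw [h2, zero_smul]
    have h3 : star a = 0 := by
      apply hh.eq_zero_of_contractTrace_mul hA
      rw [hc, Finset.sum_mul]
      exact Finset.sum_eq_zero fun i _ => by rw [mul_assoc, h1, mul_zero]
    rw [star_eq_zero] at h3
    exact ext_pair fun x => by rw [ha, h3, zero_mul, map_zero, pair_zero_left]

end Haar

namespace Dual

instance : FiniteDimensional ℂ (Dual A) :=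
  (toFunctional A).symm.finiteDimensional

/-- Evaluation at `h`, as a functional on the dual. -/
def evalAt (h : A) : Dual A →ₗ[ℂ] ℂ := Module.Dual.eval ℂ A h ∘ₗ (toFunctional A).toLinearMap

theorem isFaithfulPositive_evalAt (hA : HasFaithfulStarRep A) {h : A} (hh : IsHaar h) :
    IsFaithfulPositive (evalAt h) := by
  obtain ⟨ι, _, g, hg, hg'⟩ := hh.exists_gram hA
  have hnn : ∀ (φ : Dual A) i, 0 ≤ star (pair φ (g i)) * pair φ (g i) := fun φ i =>
    star_mul_self_nonneg _
  refine ⟨fun φ => ?_, fun φ hφ => hg' φ fun i => ?_⟩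
  · change 0 ≤ pair (star φ * φ) h
    rw [hg]
    exact Finset.sum_nonneg fun i _ => hnn φ i
  · change pair (star φ * φ) h = 0 at hφ
    rw [hg, Finset.sum_eq_zero_iff_of_nonneg fun i _ => hnn φ i] at hφ
    simpa using hφ i (Finset.mem_univ i)

/-! ### The subalgebras $\hat A^L$, $\hat A^R$ and the conditional expectations -/

section Expectations

variable {A : Type u} [Ring A] [StarRing A] [Algebra ℂ A] [StarModule ℂ A]
  [WeakStarHopfAlgebra A]

theorem pair₂_map_left (φ ψ : Dual A) {f : A →ₗ[ℂ] A} (hφ : ∀ x, pair φ (f x) = pair φ x)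
    (t : A ⊗[ℂ] A) : pair₂ φ ψ (TensorProduct.map f LinearMap.id t) = pair₂ φ ψ t := by
  induction t with
  | zero => simp
  | tmul a b => simp [hφ]
  | add s t hs ht => simp only [map_add, hs, ht]

theorem pair₂_map_right (φ ψ : Dual A) {f : A →ₗ[ℂ] A} (hψ : ∀ x, pair ψ (f x) = pair ψ x)
    (t : A ⊗[ℂ] A) : pair₂ φ ψ (TensorProduct.map LinearMap.id f t) = pair₂ φ ψ t := by
  induction t with
  | zero => simp
  | tmul a b => simp [hψ]
  | add s t hs ht => simp only [map_add, hs, ht]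

theorem pair_algebraMap (c : ℂ) (x : A) :
    pair (algebraMap ℂ (Dual A) c) x = c * counit (R := ℂ) x := by
  rw [Algebra.algebraMap_eq_smul_one, pair_smul_left, pair_one]

variable (A) in
/-- The functionals that factor through `Π^L`. -/
def leftSubalgebra : StarSubalgebra ℂ (Dual A) where
  carrier := {φ | ∀ x, pair φ (piL A x) = pair φ x}
  mul_mem' := by
    intro φ ψ hφ hψ x
    have h : ∀ t : A ⊗[ℂ] A, pair₂ φ ψ (t * (piL A x ⊗ₜ[ℂ] (1 : A))) =
        pair₂ φ ψ (t * (x ⊗ₜ[ℂ] (1 : A))) := by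
      intro t
      induction t with
      | zero => simp
      | tmul a b =>
        simp only [Algebra.TensorProduct.tmul_mul_tmul, pair₂_tmul]
        rw [← hφ (a * piL A x), piL_mul_piL, hφ]
      | add s t hs ht => simp only [map_add, add_mul, hs, ht]
    rw [pair_mul_eq, pair_mul_eq, ← pair₂_map_right φ ψ hψ, map_piL_comul, h, ← map_piL_comul,
      pair₂_map_right φ ψ hψ]
  add_mem' := fun {φ ψ} hφ hψ x => by rw [pair_add_left, pair_add_left, hφ, hψ]
  algebraMap_mem' := fun c x => by rw [pair_algebraMap, pair_algebraMap, counit_piL]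
  star_mem' := fun {φ} hφ x => by
    rw [pair_star, pair_star, ← hφ, ← piR_antipode, piL_star_piR, hφ]

variable (A) in
/-- The functionals that factor through `Π^R`. -/
def rightSubalgebra : StarSubalgebra ℂ (Dual A) where
  carrier := {φ | ∀ x, pair φ (piR A x) = pair φ x}
  mul_mem' := by
    intro φ ψ hφ hψ x
    have h : ∀ t : A ⊗[ℂ] A, pair₂ φ ψ (((1 : A) ⊗ₜ[ℂ] piR A x) * t) =
        pair₂ φ ψ (((1 : A) ⊗ₜ[ℂ] x) * t) := by
      intro t
      induction t with
      | zero => simp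
      | tmul a b =>
        simp only [Algebra.TensorProduct.tmul_mul_tmul, pair₂_tmul]
        rw [← hψ (piR A x * b), piR_piR_mul, hψ]
      | add s t hs ht => simp only [map_add, mul_add, hs, ht]
    rw [pair_mul_eq, pair_mul_eq, ← pair₂_map_left φ ψ hφ, map_piR_comul, h, ← map_piR_comul,
      pair₂_map_left φ ψ hφ]
  add_mem' := fun {φ ψ} hφ hψ x => by rw [pair_add_left, pair_add_left, hφ, hψ]
  algebraMap_mem' := fun c x => by rw [pair_algebraMap, pair_algebraMap, counit_piR]
  star_mem' := fun {φ} hφ x => by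
    rw [pair_star, pair_star, ← hφ, ← piL_antipode, piR_star_piL, hφ]

/-- `Π^L(x₍₁₎) ⊗ x₍₂₎ = S(1₍₁₎) ⊗ 1₍₂₎ x`. -/
theorem map_piL_id_comul (x : A) : TensorProduct.map (piL A) LinearMap.id (comul (R := ℂ) x) =
    TensorProduct.map antipode LinearMap.id (comul (R := ℂ) (1 : A) * ((1 : A) ⊗ₜ[ℂ] x)) := by
  have h : piL A = antipode ∘ₗ piRBar A := LinearMap.ext fun x => (antipode_piRBar x).symm
  rw [← map_piRBar_comul, h, TensorProduct.map_map, LinearMap.id_comp]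

/-- `x₍₁₎ ⊗ Π^R(x₍₂₎) = x 1₍₁₎ ⊗ S(1₍₂₎)`. -/
theorem map_id_piR_comul (x : A) : TensorProduct.map LinearMap.id (piR A) (comul (R := ℂ) x) =
    TensorProduct.map LinearMap.id antipode ((x ⊗ₜ[ℂ] (1 : A)) * comul (R := ℂ) (1 : A)) := by
  have h : piR A = antipode ∘ₗ piLBar A := LinearMap.ext fun x => (antipode_piLBar x).symm
  rw [← map_piLBar_comul, h, TensorProduct.map_map, LinearMap.id_comp]

/-- For $\varphi$ factoring through $\Pi^L$,
$\langle\varphi\psi,y\rangle=\langle\varphi,S(1_{(1)})\rangle\langle\psi,1_{(2)}y\rangle$. Here $y$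
enters only the $\psi$ factor, on the right, so multiplying it by $x$ acts on $\psi$ alone. -/
theorem arrowL_mul_left {φ : Dual A} (hφ : φ ∈ leftSubalgebra A) (ψ : Dual A) (x : A) :
    arrowL x (φ * ψ) = φ * arrowL x ψ := by
  refine ext_pair fun y => ?_
  have h : ∀ t : A ⊗[ℂ] A, TensorProduct.map (antipode : A →ₗ[ℂ] A) LinearMap.id
      (t * ((1 : A) ⊗ₜ[ℂ] (y * x))) =
      TensorProduct.map antipode LinearMap.id (t * ((1 : A) ⊗ₜ[ℂ] y)) * ((1 : A) ⊗ₜ[ℂ] x) := by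
    intro t
    induction t with
    | zero => simp
    | tmul a b => simp [mul_assoc]
    | add s t hs ht => simp only [map_add, add_mul, hs, ht]
  rw [pair_arrowL, pair_mul_eq, ← pair₂_map_left φ ψ hφ, map_piL_id_comul, h, pair_mul_eq,
    ← pair₂_map_left φ (arrowL x ψ) hφ, map_piL_id_comul, pair₂_arrowL_right]

theorem arrowL_mul_right (φ : Dual A) {ψ : Dual A} (hψ : ψ ∈ leftSubalgebra A) (x : A) :
    arrowL x (φ * ψ) = arrowL x φ * ψ := by
  refine ext_pair fun y => ?_
  rw [pair_arrowL, pair_mul_eq, ← pair₂_map_right φ ψ hψ, map_piL_comul, pair_mul_eq,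
    ← pair₂_map_right (arrowL x φ) ψ hψ, map_piL_comul, pair₂_arrowL_left, mul_assoc,
    Algebra.TensorProduct.tmul_mul_tmul, mul_one]

theorem arrowR_mul_left {φ : Dual A} (hφ : φ ∈ rightSubalgebra A) (ψ : Dual A) (x : A) :
    arrowR x (φ * ψ) = φ * arrowR x ψ := by
  refine ext_pair fun y => ?_
  rw [pair_arrowR, pair_mul_eq, ← pair₂_map_left φ ψ hφ, map_piR_comul, pair_mul_eq,
    ← pair₂_map_left φ (arrowR x ψ) hφ, map_piR_comul, pair₂_arrowR_right, ← mul_assoc,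
    Algebra.TensorProduct.tmul_mul_tmul, mul_one]

theorem arrowR_mul_right (φ : Dual A) {ψ : Dual A} (hψ : ψ ∈ rightSubalgebra A) (x : A) :
    arrowR x (φ * ψ) = arrowR x φ * ψ := by
  refine ext_pair fun y => ?_
  have h : ∀ t : A ⊗[ℂ] A, TensorProduct.map LinearMap.id (antipode : A →ₗ[ℂ] A)
      (((x * y) ⊗ₜ[ℂ] (1 : A)) * t) =
      (x ⊗ₜ[ℂ] (1 : A)) * TensorProduct.map LinearMap.id antipode ((y ⊗ₜ[ℂ] (1 : A)) * t) := by
    intro t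
    induction t with
    | zero => simp
    | tmul a b => simp [mul_assoc]
    | add s t hs ht => simp only [map_add, mul_add, hs, ht]
  rw [pair_arrowR, pair_mul_eq, ← pair₂_map_right φ ψ hψ, map_id_piR_comul, h, pair_mul_eq,
    ← pair₂_map_right (arrowR x φ) ψ hψ, map_id_piR_comul, pair₂_arrowR_left]

theorem arrowL_star (x : A) (φ : Dual A) :
    arrowL x (star φ) = star (arrowL (star (antipode x)) φ) :=
  ext_pair fun y => by
    rw [pair_arrowL, pair_star, pair_star, pair_arrowL, antipode_mul, star_mul]

theorem arrowR_star (x : A) (φ : Dual A) :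
    arrowR x (star φ) = star (arrowR (star (antipode x)) φ) :=
  ext_pair fun y => by
    rw [pair_arrowR, pair_star, pair_star, pair_arrowR, antipode_mul, star_mul]

variable {h : A} {ι : Type*} [Fintype ι] {g : ι → A}

/-- For fixed $u\otimes v$ in place of $\Delta(y)$, the factors $u$, $v$ on the left of $\Delta(h)$
are absorbed as right arrows. The Gram form then applies to $\varphi\leftarrow S(u)^*$ and
$\varphi\leftarrow v$, and its terms regroup into the left arrows by $g_i$. -/
theorem arrowL_star_mul_self
    (hg : ∀ φ ψ : Dual A, pair (star φ * ψ) h = ∑ i, star (pair φ (g i)) * pair ψ (g i))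
    (φ : Dual A) : arrowL h (star φ * φ) = ∑ i, star (arrowL (g i) φ) * arrowL (g i) φ := by
  have hsum : ∀ y, pair (∑ i, star (arrowL (g i) φ) * arrowL (g i) φ) y =
      ∑ i, pair₂ (star (arrowL (g i) φ)) (arrowL (g i) φ) (comul (R := ℂ) y) := fun y => by
    change toFunctional A _ y = _
    rw [map_sum, LinearMap.sum_apply]
    rfl
  refine ext_pair fun y => ?_
  rw [hsum, pair_arrowL, pair_mul_eq, comul_mul]
  induction comul (R := ℂ) y with
  | zero => simp
  | tmul u v =>
    have huv : u ⊗ₜ[ℂ] v = ((1 : A) ⊗ₜ[ℂ] v) * (u ⊗ₜ[ℂ] (1 : A)) := by simp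
    rw [huv, mul_assoc, ← pair₂_arrowR_right, ← pair₂_arrowR_left, arrowR_star, ← pair_mul_eq, hg,
      ← huv]
    rfl
  | add s t hs ht => simp only [map_add, add_mul, hs, ht, Finset.sum_add_distrib]

theorem arrowR_star_mul_self
    (hg : ∀ φ ψ : Dual A, pair (star φ * ψ) h = ∑ i, star (pair φ (g i)) * pair ψ (g i))
    (φ : Dual A) : arrowR h (star φ * φ) = ∑ i, star (arrowR (g i) φ) * arrowR (g i) φ := by
  have hsum : ∀ y, pair (∑ i, star (arrowR (g i) φ) * arrowR (g i) φ) y =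
      ∑ i, pair₂ (star (arrowR (g i) φ)) (arrowR (g i) φ) (comul (R := ℂ) y) := fun y => by
    change toFunctional A _ y = _
    rw [map_sum, LinearMap.sum_apply]
    rfl
  refine ext_pair fun y => ?_
  rw [hsum, pair_arrowR, pair_mul_eq, comul_mul]
  induction comul (R := ℂ) y with
  | zero => simp
  | tmul u v =>
    have huv : u ⊗ₜ[ℂ] v = (u ⊗ₜ[ℂ] (1 : A)) * ((1 : A) ⊗ₜ[ℂ] v) := by simp
    rw [huv, ← mul_assoc, ← pair₂_arrowL_right, ← pair₂_arrowL_left, arrowL_star, ← pair_mul_eq,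
      hg, ← huv]
    rfl
  | add s t hs ht => simp only [map_add, mul_add, hs, ht, Finset.sum_add_distrib]

theorem _root_.IsPositiveElement.map {B : Type u} [Ring B] [StarRing B] [Algebra ℂ B]
    {E : B →ₗ[ℂ] B} (hE : ∀ y, IsPositiveElement (E (star y * y))) {b : B}
    (hb : IsPositiveElement b) : IsPositiveElement (E b) := by
  induction hb using AddSubmonoid.closure_induction with
  | mem x hx =>
    obtain ⟨y, rfl⟩ := hx
    exact hE y
  | zero => rw [map_zero]; exact AddSubmonoid.zero_mem _
  | add x y _ _ hx hy => rw [map_add]; exact AddSubmonoid.add_mem _ hx hy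

variable [FiniteDimensional ℂ A]

theorem isConditionalExpectation_arrowL (hA : HasFaithfulStarRep A) (hh : IsHaar h) :
    IsConditionalExpectation (arrowL h) (leftSubalgebra A) where
  mem φ := fun x => by rw [pair_arrowL, pair_arrowL, hh.left_integral x]
  -- Normalization enters here: $\Pi^L(xh)=\Pi^L(x\Pi^L(h))=\Pi^L(x)$.
  apply_of_mem φ hφ := ext_pair fun x => by
    rw [pair_arrowL, ← hφ, ← piL_mul_piL, hh.piL_eq_one, mul_one, hφ]
  bimodule φ hφ ψ hψ b := by rw [arrowL_mul_right _ hψ, arrowL_mul_left hφ]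
  map_star φ := by rw [arrowL_star, hh.antipode_eq, hh.star_eq]
  positive φ hφ := by
    obtain ⟨ι, _, g, hg, -⟩ := hh.exists_gram hA
    refine hφ.map fun ψ => ?_
    rw [arrowL_star_mul_self hg]
    exact AddSubmonoid.sum_mem _ fun i _ => AddSubmonoid.subset_closure ⟨_, rfl⟩

theorem isConditionalExpectation_arrowR (hA : HasFaithfulStarRep A) (hh : IsHaar h) :
    IsConditionalExpectation (arrowR h) (rightSubalgebra A) where
  mem φ := fun x => by rw [pair_arrowR, pair_arrowR, hh.right_integral x]
  apply_of_mem φ hφ := ext_pair fun x => by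
    rw [pair_arrowR, ← hφ, ← piR_piR_mul, hh.piR_eq_one, one_mul, hφ]
  bimodule φ hφ ψ hψ b := by rw [arrowR_mul_right _ hψ, arrowR_mul_left hφ]
  map_star φ := by rw [arrowR_star, hh.antipode_eq, hh.star_eq]
  positive φ hφ := by
    obtain ⟨ι, _, g, hg, -⟩ := hh.exists_gram hA
    refine hφ.map fun ψ => ?_
    rw [arrowR_star_mul_self hg]
    exact AddSubmonoid.sum_mem _ fun i _ => AddSubmonoid.subset_closure ⟨_, rfl⟩

end Expectations

/-! ### The weak $*$-Hopf algebra structure of the dual -/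

section DualStructure

variable {A : Type u} [Ring A] [StarRing A] [Algebra ℂ A] [StarModule ℂ A]
  [WeakStarHopfAlgebra A]

/-- The pairing of `Â ⊗ Â` with `A ⊗ A`. -/
def pairTensor : Dual A ⊗[ℂ] Dual A →ₗ[ℂ] Module.Dual ℂ (A ⊗[ℂ] A) :=
  TensorProduct.dualDistrib ℂ A A ∘ₗ
    TensorProduct.map (toFunctional A).toLinearMap (toFunctional A).toLinearMap

@[simp] theorem pairTensor_tmul_tmul (φ ψ : Dual A) (x y : A) :
    pairTensor (φ ⊗ₜ[ℂ] ψ) (x ⊗ₜ[ℂ] y) = pair φ x * pair ψ y := rfl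

theorem pairTensor_tmul (φ ψ : Dual A) (t : A ⊗[ℂ] A) :
    pairTensor (φ ⊗ₜ[ℂ] ψ) t = pair₂ φ ψ t := by
  induction t with
  | zero => simp
  | tmul a b => simp
  | add s t hs ht => simp only [map_add, hs, ht]

/-- Contraction of the first leg of `Â ⊗ M` with an element of `A`. -/
def contractLeft (M : Type u) [AddCommGroup M] [Module ℂ M] (x : A) : Dual A ⊗[ℂ] M →ₗ[ℂ] M :=
  (TensorProduct.lid ℂ M).toLinearMap ∘ₗ TensorProduct.map (evalAt x) LinearMap.id

@[simp] theorem contractLeft_tmul {M : Type u} [AddCommGroup M] [Module ℂ M] (x : A) (φ : Dual A)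
    (m : M) : contractLeft M x (φ ⊗ₜ[ℂ] m) = pair φ x • m := rfl

theorem dualAntipode_mul (φ ψ : Dual A) :
    dualAntipode (φ * ψ) = dualAntipode ψ * dualAntipode φ := by
  refine ext_pair fun x => ?_
  change pair (φ * ψ) (antipode x) = _
  rw [pair_mul_eq, pair_mul_eq, comul_antipode]
  induction comul (R := ℂ) x with
  | zero => simp
  | tmul a b => exact mul_comm _ _
  | add s t hs ht => simp only [map_add, hs, ht]

theorem pair_dualAntipode (φ : Dual A) (x : A) : pair (dualAntipode φ) x = pair φ (antipode x) :=
  rfl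

theorem dualAntipode_star (φ : Dual A) :
    dualAntipode (star (dualAntipode (star φ))) = φ := by
  refine ext_pair fun x => ?_
  rw [pair_dualAntipode, pair_star, pair_dualAntipode, pair_star, star_star, star_antipode,
    star_antipode_star_antipode, symm_antipode_apply]

theorem pairTensor_mul (S T : Dual A ⊗[ℂ] Dual A) (x y : A) :
    pairTensor (S * T) (x ⊗ₜ[ℂ] y) = LinearMap.mul' ℂ ℂ (TensorProduct.map (pairTensor S)
      (pairTensor T) (TensorProduct.tensorTensorTensorComm ℂ A A A A
        (comul (R := ℂ) x ⊗ₜ[ℂ] comul (R := ℂ) y))) := by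
  induction S with
  | zero => simp
  | add S₁ S₂ h₁ h₂ => simp only [add_mul, map_add, LinearMap.add_apply, h₁, h₂,
      TensorProduct.map_add_left]
  | tmul φ ψ =>
    induction T with
    | zero => simp
    | add T₁ T₂ h₁ h₂ => simp only [mul_add, map_add, LinearMap.add_apply, h₁, h₂,
        TensorProduct.map_add_right]
    | tmul φ' ψ' =>
      rw [Algebra.TensorProduct.tmul_mul_tmul, pairTensor_tmul_tmul, pair_mul_eq, pair_mul_eq]
      induction comul (R := ℂ) x with
      | zero => simp
      | add s t hs ht => simp only [map_add, add_mul, TensorProduct.add_tmul, hs, ht]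
      | tmul a b =>
        induction comul (R := ℂ) y with
        | zero => simp
        | add s t hs ht => simp only [map_add, mul_add, TensorProduct.tmul_add, hs, ht]
        | tmul c d => simp [mul_mul_mul_comm]

theorem pairTensor_star (T : Dual A ⊗[ℂ] Dual A) (x y : A) :
    pairTensor (star T) (x ⊗ₜ[ℂ] y) =
      star (pairTensor T (star (antipode x) ⊗ₜ[ℂ] star (antipode y))) := by
  induction T with
  | zero => simp
  | tmul φ ψ => simp [pair_star]
  | add S T hS hT => simp only [star_add, map_add, LinearMap.add_apply, hS, hT]

/-- With $b=1_{(1)}\langle\varphi,1_{(2)}\rangle$ one has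
$\langle\varphi^*\varphi,1\rangle=\varepsilon(b^*b)$, so positivity of $\hat\varepsilon$ comes from
that of $\varepsilon$. The identity uses that $\Delta(1)$ is fixed by $*$, by
$\Pi^R\otimes\mathrm{id}$, and by $S\otimes S$ after the flip. -/
theorem dualCounit_star_mul_self_nonneg (φ : Dual A) : 0 ≤ pair (star φ * φ) (1 : A) := by
  set b : A ⊗[ℂ] A →ₗ[ℂ] A :=
    (TensorProduct.rid ℂ A).toLinearMap ∘ₗ TensorProduct.map LinearMap.id (toFunctional A φ) with hb
  have hbt : ∀ x y, b (x ⊗ₜ[ℂ] y) = pair φ y • x := fun x y => rfl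
  have h1 : ∀ (a : A) (t : A ⊗[ℂ] A), counit (R := ℂ) (a * b t) =
      pair φ (TensorProduct.lid ℂ A (TensorProduct.map (counit (R := ℂ)) LinearMap.id
        ((a ⊗ₜ[ℂ] (1 : A)) * t))) := by
    intro a t
    induction t with
    | zero => simp
    | tmul x y => simp [hbt, mul_comm]
    | add s t hs ht => simp only [map_add, mul_add, hs, ht, pair_add_right]
  have h2 : ∀ t : A ⊗[ℂ] A, counit (R := ℂ) (star (b (star t)) * b (comul (R := ℂ) (1 : A))) =
      pair₂ φ (star φ) (TensorProduct.map (antipodeEquiv A).symm.toLinearMap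
        (antipodeEquiv A).symm.toLinearMap (TensorProduct.map (piR A) LinearMap.id t)) := by
    intro t
    induction t with
    | zero => simp
    | tmul x y =>
      rw [TensorProduct.star_tmul, hbt, star_smul, star_star, smul_mul_assoc, map_smul, h1,
        ← piLBar_eq]
      simp only [TensorProduct.map_tmul, pair₂_tmul, LinearEquiv.coe_coe, LinearMap.id_apply,
        pair_star, antipode_symm_apply]
      rw [smul_eq_mul, mul_comm]
      rfl
    | add s t hs ht => simp only [map_add, star_add, add_mul, hs, ht]
  have h3 : TensorProduct.map (piR A) LinearMap.id (comul (R := ℂ) (1 : A)) =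
      comul (R := ℂ) (1 : A) := by
    rw [map_piR_comul, ← Algebra.TensorProduct.one_def, one_mul]
  have h4 : ∀ t : A ⊗[ℂ] A, pair₂ φ (star φ) (TensorProduct.map (antipodeEquiv A).symm.toLinearMap
      (antipodeEquiv A).symm.toLinearMap
        (TensorProduct.map antipode antipode (TensorProduct.comm ℂ A A t))) =
      pair₂ (star φ) φ t := by
    intro t
    induction t with
    | zero => simp
    | tmul x y => simp [symm_antipode_apply, mul_comm]
    | add s t hs ht => simp only [map_add, hs, ht]
  have h5 := h2 (comul (R := ℂ) (1 : A))
  have h6 := comul_antipode (1 : A)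
  rw [antipode_one] at h6
  rw [h3, star_comul_one] at h5
  nth_rewrite 3 [h6] at h5
  rw [h4] at h5
  rw [pair_mul_eq, ← h5]
  exact counit_star_mul_self_nonneg _

variable [FiniteDimensional ℂ A]

theorem tensor_ext {S T : Dual A ⊗[ℂ] Dual A}
    (h : ∀ x y, pairTensor S (x ⊗ₜ[ℂ] y) = pairTensor T (x ⊗ₜ[ℂ] y)) : S = T := by
  have h1 : pairTensor S = pairTensor T := TensorProduct.ext' h
  exact (TensorProduct.congr (toFunctional A) (toFunctional A)).injective
    ((TensorProduct.dualDistribEquiv ℂ A A).injective h1)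

theorem tensor_ext_contractLeft {M : Type u} [AddCommGroup M] [Module ℂ M] {S T : Dual A ⊗[ℂ] M}
    (h : ∀ x : A, contractLeft M x S = contractLeft M x T) : S = T := by
  have h1 : ∀ (U : Dual A ⊗[ℂ] M) (x : A), contractLeft M x U =
      dualTensorHom ℂ A M (TensorProduct.map (toFunctional A).toLinearMap LinearMap.id U) x := by
    intro U x
    induction U with
    | zero => simp
    | tmul φ m => rfl
    | add S T hS hT => simp only [map_add, LinearMap.add_apply, hS, hT]
  refine (TensorProduct.congr (toFunctional A) (LinearEquiv.refl ℂ M)).injective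
    ((dualTensorHomEquiv ℂ A M).injective (LinearMap.ext fun x => ?_))
  have h2 := h x
  rw [h1, h1] at h2
  exact h2

theorem pairTensor_dualComul (φ : Dual A) (t : A ⊗[ℂ] A) :
    pairTensor (dualComul φ) t = pair φ (LinearMap.mul' ℂ A t) := by
  induction t with
  | zero => simp
  | tmul x y => exact pair_dualComul φ x y
  | add s t hs ht => simp only [map_add, hs, ht, pair_add_right]

theorem pairTensor_dualComul_tmul (φ : Dual A) (x y : A) :
    pairTensor (dualComul φ) (x ⊗ₜ[ℂ] y) = pair φ (x * y) :=
  pair_dualComul φ x y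

theorem contractLeft_dualComul (φ : Dual A) (x : A) :
    contractLeft (Dual A) x (dualComul φ) = arrowR x φ := (arrowR_eq x φ).symm

/-- $\hat\Pi^L$ is the transpose of the idempotent $\Pi^L$, so its image consists of the functionals
that factor through $\Pi^L$. -/
theorem targetMap_dual (φ : Dual A) (x : A) :
    pair (targetMap dualComul dualAntipode φ) x = pair φ (piL A x) := by
  have h1 : ∀ T : Dual A ⊗[ℂ] Dual A,
      pair (LinearMap.mul' ℂ (Dual A) (TensorProduct.map LinearMap.id dualAntipode T)) x =
      pairTensor T (TensorProduct.map LinearMap.id antipode (comul (R := ℂ) x)) := by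
    intro T
    induction T with
    | zero => simp
    | tmul φ ψ =>
      rw [TensorProduct.map_tmul, LinearMap.mul'_apply, pair_mul_eq, pairTensor_tmul]
      induction comul (R := ℂ) x with
      | zero => simp
      | tmul a b => rfl
      | add s t hs ht => simp only [map_add, hs, ht]
    | add S T hS hT => simp only [map_add, LinearMap.add_apply, pair_add_left, hS, hT]
  simp only [targetMap, LinearMap.comp_apply, h1, pairTensor_dualComul, piL]

theorem sourceMap_dual (φ : Dual A) (x : A) :
    pair (sourceMap dualComul dualAntipode φ) x = pair φ (piR A x) := by
  have h1 : ∀ T : Dual A ⊗[ℂ] Dual A,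
      pair (LinearMap.mul' ℂ (Dual A) (TensorProduct.map dualAntipode LinearMap.id T)) x =
      pairTensor T (TensorProduct.map antipode LinearMap.id (comul (R := ℂ) x)) := by
    intro T
    induction T with
    | zero => simp
    | tmul φ ψ =>
      rw [TensorProduct.map_tmul, LinearMap.mul'_apply, pair_mul_eq, pairTensor_tmul]
      induction comul (R := ℂ) x with
      | zero => simp
      | tmul a b => rfl
      | add s t hs ht => simp only [map_add, hs, ht]
    | add S T hS hT => simp only [map_add, LinearMap.add_apply, pair_add_left, hS, hT]
  simp only [sourceMap, LinearMap.comp_apply, h1, pairTensor_dualComul, piR]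

theorem coe_leftSubalgebra : (leftSubalgebra A : Set (Dual A)) =
    Set.range (targetMap (dualComul (A := A)) dualAntipode) := by
  ext φ
  constructor
  · intro hφ
    exact ⟨φ, ext_pair fun x => by rw [targetMap_dual, hφ]⟩
  · rintro ⟨φ, rfl⟩ x
    rw [targetMap_dual, targetMap_dual, piL_piL]

theorem coe_rightSubalgebra : (rightSubalgebra A : Set (Dual A)) =
    Set.range (sourceMap (dualComul (A := A)) dualAntipode) := by
  ext φ
  constructor
  · intro hφ
    exact ⟨φ, ext_pair fun x => by rw [sourceMap_dual, hφ]⟩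
  · rintro ⟨φ, rfl⟩ x
    rw [sourceMap_dual, sourceMap_dual, piR_piR]

theorem dualComul_mul (φ ψ : Dual A) :
    dualComul (φ * ψ) = dualComul φ * dualComul ψ := by
  refine tensor_ext fun x y => ?_
  rw [pairTensor_dualComul_tmul, pairTensor_mul, pair_mul_eq, comul_mul]
  induction comul (R := ℂ) x with
  | zero => simp
  | add s t hs ht => simp only [map_add, add_mul, TensorProduct.add_tmul, hs, ht]
  | tmul a b =>
    induction comul (R := ℂ) y with
    | zero => simp
    | add s t hs ht => simp only [map_add, mul_add, TensorProduct.tmul_add, hs, ht]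
    | tmul c d => simp [pairTensor_dualComul_tmul]

theorem dualComul_star (φ : Dual A) : dualComul (star φ) = star (dualComul φ) := by
  refine tensor_ext fun x y => ?_
  rw [pairTensor_dualComul_tmul, pairTensor_star, pairTensor_dualComul_tmul, pair_star,
    antipode_mul, star_mul]

theorem dualComul_antipode (φ : Dual A) : dualComul (dualAntipode φ) =
    TensorProduct.map dualAntipode dualAntipode
      (TensorProduct.comm ℂ (Dual A) (Dual A) (dualComul φ)) := by
  refine tensor_ext fun x y => ?_
  have h : ∀ T : Dual A ⊗[ℂ] Dual A, pairTensor (TensorProduct.map dualAntipode dualAntipode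
      (TensorProduct.comm ℂ (Dual A) (Dual A) T)) (x ⊗ₜ[ℂ] y) =
      pairTensor T (antipode y ⊗ₜ[ℂ] antipode x) := by
    intro T
    induction T with
    | zero => simp
    | tmul φ ψ => exact mul_comm _ _
    | add S T hS hT => simp only [map_add, LinearMap.add_apply, hS, hT]
  rw [h, pairTensor_dualComul_tmul, pairTensor_dualComul_tmul, pair_dualAntipode, antipode_mul]

/-- Paired with $x\otimes y$, this is $\Pi^R(x)y=y_{(1)}\varepsilon(xy_{(2)})$ evaluated under
$\varphi$. -/
theorem dualAntipode_axiom (φ : Dual A) :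
    TensorProduct.map (sourceMap dualComul dualAntipode) LinearMap.id (dualComul φ) =
      ((1 : Dual A) ⊗ₜ[ℂ] φ) * dualComul (1 : Dual A) := by
  refine tensor_ext fun x y => ?_
  have h1 : ∀ T : Dual A ⊗[ℂ] Dual A, pairTensor (TensorProduct.map
      (sourceMap dualComul dualAntipode) LinearMap.id T) (x ⊗ₜ[ℂ] y) =
      pairTensor T (piR A x ⊗ₜ[ℂ] y) := by
    intro T
    induction T with
    | zero => simp
    | tmul φ ψ => simp [sourceMap_dual]
    | add S T hS hT => simp only [map_add, LinearMap.add_apply, hS, hT]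
  have h2 : ∀ T : Dual A ⊗[ℂ] Dual A, pairTensor (((1 : Dual A) ⊗ₜ[ℂ] φ) * T) (x ⊗ₜ[ℂ] y) =
      pair φ (TensorProduct.rid ℂ A (TensorProduct.map LinearMap.id
        (pairTensor T ∘ₗ TensorProduct.mk ℂ A A x) (comul (R := ℂ) y))) := by
    intro T
    induction T with
    | zero => simp
    | tmul f g =>
      rw [Algebra.TensorProduct.tmul_mul_tmul, one_mul, pairTensor_tmul_tmul, pair_mul_eq]
      induction comul (R := ℂ) y with
      | zero => simp
      | tmul a b => simp; ring
      | add s t hs ht => simp only [map_add, mul_add, pair_add_right, hs, ht]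
    | add S T hS hT =>
      simp only [mul_add, map_add, LinearMap.add_apply, hS, hT, LinearMap.add_comp,
        TensorProduct.map_add_right, pair_add_right]
  have h3 : pairTensor (dualComul (1 : Dual A)) ∘ₗ TensorProduct.mk ℂ A A x =
      counit ∘ₗ LinearMap.mulLeft ℂ x :=
    LinearMap.ext fun z => pairTensor_dualComul_tmul 1 x z
  rw [h1, h2, h3, ← piR_mul_eq, pairTensor_dualComul_tmul]

/-- The right side is $\varepsilon(uv)$ with $u=\langle\varphi,1_{(1)}\rangle1_{(2)}$ and
$v=1_{(1)}\langle\psi,1_{(2)}\rangle$. Contracting $u$ gives $\varphi$ at `piRBar A v`, which is $v$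
because `piRBar` on the first leg fixes $\Delta(1)$. -/
theorem dualCounit_mul (φ ψ : Dual A) : dualCounit (φ * ψ) =
    LinearMap.mul' ℂ ℂ (TensorProduct.map dualCounit dualCounit
      ((φ ⊗ₜ[ℂ] (1 : Dual A)) * dualComul (1 : Dual A) * ((1 : Dual A) ⊗ₜ[ℂ] ψ))) := by
  set u : A ⊗[ℂ] A →ₗ[ℂ] A :=
    (TensorProduct.lid ℂ A).toLinearMap ∘ₗ TensorProduct.map (toFunctional A φ) LinearMap.id with hu
  set v : A ⊗[ℂ] A →ₗ[ℂ] A :=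
    (TensorProduct.rid ℂ A).toLinearMap ∘ₗ TensorProduct.map LinearMap.id (toFunctional A ψ) with hv
  have hut : ∀ x y, u (x ⊗ₜ[ℂ] y) = pair φ x • y := fun x y => rfl
  have hvt : ∀ x y, v (x ⊗ₜ[ℂ] y) = pair ψ y • x := fun x y => rfl
  have h1 : ∀ (f : Dual A) (t : A ⊗[ℂ] A), pair f (u t) = pair₂ φ f t := by
    intro f t
    induction t with
    | zero => simp
    | tmul x y => simp [hut]
    | add s t hs ht => simp only [map_add, pair_add_right, hs, ht]
  have h2 : ∀ (f : Dual A) (t : A ⊗[ℂ] A), pair f (v t) = pair₂ f ψ t := by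
    intro f t
    induction t with
    | zero => simp
    | tmul x y => simp [hvt, mul_comm]
    | add s t hs ht => simp only [map_add, pair_add_right, hs, ht]
  have h3 : ∀ T : Dual A ⊗[ℂ] Dual A, LinearMap.mul' ℂ ℂ (TensorProduct.map dualCounit dualCounit
      ((φ ⊗ₜ[ℂ] (1 : Dual A)) * T * ((1 : Dual A) ⊗ₜ[ℂ] ψ))) =
      pairTensor T (u (comul (R := ℂ) (1 : A)) ⊗ₜ[ℂ] v (comul (R := ℂ) (1 : A))) := by
    intro T
    induction T with
    | zero => simp
    | tmul f g =>
      rw [pairTensor_tmul_tmul, h1, h2]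
      simp only [Algebra.TensorProduct.tmul_mul_tmul, one_mul, mul_one]
      rfl
    | add S T hS hT => simp only [mul_add, add_mul, map_add, LinearMap.add_apply, hS, hT]
  have h4 : ∀ (t : A ⊗[ℂ] A) (a : A), counit (R := ℂ) (u t * a) = pair φ (TensorProduct.rid ℂ A
      (TensorProduct.map LinearMap.id counit (t * ((1 : A) ⊗ₜ[ℂ] a)))) := by
    intro t a
    induction t with
    | zero => simp
    | tmul x y => simp [hut, mul_comm]
    | add s t hs ht => simp only [map_add, add_mul, pair_add_right, hs, ht]
  have h5 : ∀ t : A ⊗[ℂ] A, piRBar A (v t) = v (TensorProduct.map (piRBar A) LinearMap.id t) := by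
    intro t
    induction t with
    | zero => simp
    | tmul x y => simp [hvt]
    | add s t hs ht => simp only [map_add, hs, ht]
  rw [h3, pairTensor_dualComul_tmul, pair_one, h4, ← piRBar_eq, h5, map_piRBar_comul,
    ← Algebra.TensorProduct.one_def, mul_one, h2]
  rfl

/-- Associativity of $A$: contracting the first leg with $x$ and pairing the rest with $y\otimes z$
leaves $\varphi$ at the two bracketings of $xyz$. -/
theorem dualComul_coassoc (φ : Dual A) :
    TensorProduct.assoc ℂ (Dual A) (Dual A) (Dual A) (dualComul.rTensor (Dual A) (dualComul φ)) =
      dualComul.lTensor (Dual A) (dualComul φ) := by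
  refine tensor_ext_contractLeft fun x => ?_
  have h1 : ∀ T : Dual A ⊗[ℂ] Dual A,
      contractLeft _ x (dualComul.lTensor (Dual A) T) = dualComul (contractLeft _ x T) := by
    intro T
    induction T with
    | zero => simp
    | tmul f g => simp
    | add S T hS hT => simp only [map_add, hS, hT]
  have h2 : ∀ T : Dual A ⊗[ℂ] Dual A, contractLeft _ x (TensorProduct.assoc ℂ _ _ _
      (dualComul.rTensor (Dual A) T)) = (arrowR x).rTensor (Dual A) T := by
    intro T
    induction T with
    | zero => simp
    | tmul f g =>
      rw [LinearMap.rTensor_tmul, LinearMap.rTensor_tmul, ← contractLeft_dualComul]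
      induction dualComul f with
      | zero => simp
      | tmul a b => simp [TensorProduct.smul_tmul']
      | add S T hS hT => simp only [map_add, TensorProduct.add_tmul, hS, hT]
    | add S T hS hT => simp only [map_add, hS, hT]
  rw [h1, h2, contractLeft_dualComul]
  refine tensor_ext fun y z => ?_
  have h3 : ∀ T : Dual A ⊗[ℂ] Dual A, pairTensor ((arrowR x).rTensor (Dual A) T) (y ⊗ₜ[ℂ] z) =
      pairTensor T ((x * y) ⊗ₜ[ℂ] z) := by
    intro T
    induction T with
    | zero => simp
    | tmul f g => rfl
    | add S T hS hT => simp only [map_add, LinearMap.add_apply, hS, hT]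
  rw [h3, pairTensor_dualComul_tmul, pairTensor_dualComul_tmul, pair_arrowR, mul_assoc]

variable (A) in
/-- The coalgebra structure of the dual. -/
@[reducible] def dualCoalgebra : Coalgebra ℂ (Dual A) where
  comul := dualComul
  counit := dualCounit
  coassoc := LinearMap.ext dualComul_coassoc
  rTensor_counit_comp_comul := LinearMap.ext fun φ => by
    apply (TensorProduct.lid ℂ (Dual A)).injective
    have h := arrowR_eq 1 φ
    have h' : arrowR 1 φ = φ := ext_pair fun y => by rw [pair_arrowR, one_mul]
    rw [h'] at h
    refine h.symm.trans ?_
    rw [TensorProduct.mk_apply, TensorProduct.lid_tmul, one_smul]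
  lTensor_counit_comp_comul := LinearMap.ext fun φ => by
    apply (TensorProduct.rid ℂ (Dual A)).injective
    have h := arrowL_eq 1 φ
    have h' : arrowL 1 φ = φ := ext_pair fun y => by rw [pair_arrowL, mul_one]
    rw [h'] at h
    refine h.symm.trans ?_
    rw [LinearMap.flip_apply, TensorProduct.mk_apply, TensorProduct.rid_tmul, one_smul]

variable (A) in
/-- The dual of a finite dimensional weak `*`-Hopf algebra. -/
@[reducible] def dualWeakStarHopfAlgebra : WeakStarHopfAlgebra (Dual A) where
  __ := dualCoalgebra A
  antipode := dualAntipode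
  comul_mul := dualComul_mul
  comul_star := dualComul_star
  counit_mul := dualCounit_mul
  counit_star_mul_self_nonneg := dualCounit_star_mul_self_nonneg
  antipode_mul := dualAntipode_mul
  antipode_star := dualAntipode_star
  comul_antipode := dualComul_antipode
  antipode_axiom := dualAntipode_axiom

end DualStructure

end Dual

end WeakStarHopfAlgebra

end

theorem mainTheorem5 {A : Type u} [Ring A] [StarRing A] [Algebra ℂ A] [StarModule ℂ A]
    [WeakStarHopfAlgebra A] [FiniteDimensional ℂ A] (hA : HasFaithfulStarRep A) :
    -- existence and uniqueness of the Haar measure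
    (∃! h : A, IsHaar h) ∧
    (∀ h : A, IsHaar h →
      -- `h` is a self-adjoint, `S`-invariant projection
      (h * h = h ∧ star h = h ∧ antipode h = h) ∧
      -- `φ ↦ ⟨φ, h⟩` is positive and faithful
      (∀ φ : Dual A, 0 ≤ pair (star φ * φ) h) ∧
      (∀ φ : Dual A, pair (star φ * φ) h = 0 → φ = 0) ∧
      (∀ φ : Dual A, IsPositiveElement φ → pair φ h = 0 → φ = 0) ∧
      -- the value at the unit of the dual is `N = ε(1)`
      pair (1 : Dual A) h = counit (R := ℂ) (1 : A) ∧
      -- `h₍₁₎ x ⊗ h₍₂₎ = h₍₁₎ ⊗ h₍₂₎ S(x)`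
      (∀ x : A, comul (R := ℂ) h * (x ⊗ₜ[ℂ] (1 : A)) =
        comul (R := ℂ) h * ((1 : A) ⊗ₜ[ℂ] antipode x)) ∧
      -- left and right invariance
      (∀ (x : A) (φ ψ : Dual A),
        pair (arrowL x φ * ψ) h = pair (φ * arrowL (antipode x) ψ) h) ∧
      (∀ (x : A) (φ ψ : Dual A),
        pair (arrowR x φ * ψ) h = pair (φ * arrowR ((antipodeEquiv A).symm x) ψ) h) ∧
      -- `φ ↦ (h → φ)` and `φ ↦ (φ ← h)` are conditional expectations onto the images of
      -- the maps `φ ↦ φ₍₁₎ Ŝ(φ₍₂₎)` and `φ ↦ Ŝ(φ₍₁₎) φ₍₂₎` of the dual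
      (∃ C : StarSubalgebra ℂ (Dual A),
        (C : Set (Dual A)) = Set.range (targetMap (dualComul (A := A)) dualAntipode) ∧
        IsConditionalExpectation (arrowL h) C) ∧
      (∃ C : StarSubalgebra ℂ (Dual A),
        (C : Set (Dual A)) = Set.range (sourceMap (dualComul (A := A)) dualAntipode) ∧
        IsConditionalExpectation (arrowR h) C)) ∧
    -- the dual is again a weak C*-Hopf algebra
    HasFaithfulStarRep (Dual A) ∧
    (∃ D : WeakStarHopfAlgebra (Dual A),
      D.comul = dualComul ∧ D.counit = dualCounit ∧ D.antipode = dualAntipode) := by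
  refine ⟨?_, fun h hh => ⟨⟨hh.mul_self, hh.star_eq, hh.antipode_eq⟩,
    (isFaithfulPositive_evalAt hA hh).nonneg, (isFaithfulPositive_evalAt hA hh).definite,
    fun φ hφ h0 => ?_, hh.counit_eq, hh.comul_mul_tmul, pair_arrowL_mul hh, pair_arrowR_mul hh,
    ⟨leftSubalgebra A, coe_leftSubalgebra, isConditionalExpectation_arrowL hA hh⟩,
    ⟨rightSubalgebra A, coe_rightSubalgebra, isConditionalExpectation_arrowR hA hh⟩⟩, ?_,
    ⟨dualWeakStarHopfAlgebra A, rfl, rfl, rfl⟩⟩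
  · obtain ⟨h, hh⟩ := exists_isHaar hA
    exact ⟨h, hh, fun k hk => hk.eq hh⟩
  · exact (isFaithfulPositive_evalAt hA hh).eq_zero_of_isPositiveElement hφ h0
  · obtain ⟨h, hh⟩ := exists_isHaar hA
    exact (isFaithfulPositive_evalAt hA hh).hasFaithfulStarRep
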